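/- **Ground-state degeneracy of the $n$-Cluster-Ising chain with frustrated boundary conditions.** Let $n\ge 0$ be even, let $N$ be odd with $n+2<N$, let $\lambda\in\mathbb R$, and consider on $(\mathbb C^2)^{\otimes N}$ $$H=\sum_{j=1}^N\sigma^x_j\sigma^x_{j+1}+\lambda\sum_{j=1}^N\sigma^y_j\big(\sigma^z_{j+1}\cdots\sigma^z_{j+n}\big)\sigma^y_{j+n+1},\qquad \sigma^\alpha_{j+N}=\sigma^\alpha_j .$$ Put $g=\gcd(N,n+2)$, $\Pi^x=\prod_j\sigma^x_j$, $\Gamma^-=\{2\pi k/N:\ 0\le k\le N-1\}$, and let $T$ be the translation operator with $T^\dagger\sigma^\alpha_jT=\sigma^\alpha_{j+1}$. Define $c_j=\big(\prod_{l<j}\sigma^z_l\big)\frac{\sigma^x_j+i\sigma^y_j}{2}$, $b_q=N^{-1/2}\sum_{j=1}^N c_j e^{-iqj}$, the angle $\theta_q\in(-\pi/2,\pi/2]$ by $$e^{2i\theta_q}=e^{iq}\,\frac{1+\lambda e^{-i(n+2)q}}{|1+\lambda e^{-i(n+2)q}|},$$ $a_q=\cos\theta_q\,b_q+i\sin\theta_q\,b_{-q}^\dagger$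 for $q\ne 0$ and $a_0=b_0$ $(q\in\Gamma^-)$, $$|0^-\rangle=\prod_{q\in\Gamma^-,\ 0<q<\pi}\big(\cos\theta_q-i\sin\theta_q\,b_q^\dagger b_{-q}^\dagger\big)\,|\!\uparrow\uparrow\cdots\uparrow\rangle ,$$ and $\varepsilon_q=2|1+\lambda e^{i(n+2)q}|$ for $q\in\Gamma^-\setminus\{0\}$, $\varepsilon_0=2(1+\lambda)$. Let $Q\subseteq\Gamma^-$ be the set of momenta $q\in\Gamma^-$ at which $\varepsilon_q$ is minimal. (The ground space is the eigenspace of the smallest eigenvalue of $H$.) 1. For $\lambda\in(-1,1)$ the states $a_q^\dagger|0^-\rangle$ and $\Pi^xa_q^\dagger|0^-\rangle$, $q\in Q$, are linearly independent and span the ground space of $H$, and both are eigenvectors of $T$ with eigenvalue $e^{iq}$. 2. For $\lambda\in(0,1)$ the ground space has dimension exactly $4g$, and $Q=\{q\in\Gamma^-:\cos((n+2)q)=-\cos(\pi g/N)\}$ has exactly $2g$ elements. 3. For $\lambda\in(-1,0)$ the ground space has dimension exactly $2g$, and $Q=\{q\in\Gamma^-:\cos((n+2)q)=1\}$ has exactly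 $g$ elements. 4. Let $n=4$ and $\lambda\in(0,1)$. If $N\equiv1\pmod{12}$, the ground space has dimension $4$ and $$Q=\Big\{\tfrac{2\pi}{N}\tfrac{N-1}{12},\ \tfrac{2\pi}{N}\tfrac{11N+1}{12}\Big\}.$$ If $N\equiv3\pmod{12}$, the ground space has dimension $12$ and $$Q=\Big\{\tfrac{2\pi}{N}\tfrac{N-3}{12},\ \tfrac{2\pi}{N}\tfrac{3N+3}{12},\ \tfrac{2\pi}{N}\tfrac{5N-3}{12},\ \tfrac{2\pi}{N}\tfrac{7N+3}{12},\ \tfrac{2\pi}{N}\tfrac{9N-3}{12},\ \tfrac{2\pi}{N}\tfrac{11N+3}{12}\Big\}.$$ -/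

import Mathlib

noncomputable section

namespace ClusterIsing

open Matrix

/-- Spin configurations of a chain of `N` sites, with `0` for spin up and `1` for spin down along
`z`. The site with index `j : Fin N` is the site number `j + 1` of the chain `1, …, N`; addition in
`Fin N` is modulo `N`, which is the periodic boundary condition. -/
abbrev Config (N : ℕ) : Type := Fin N → Fin 2

/-- Vectors of the Hilbert space `(ℂ²)^{⊗ N}`, by their components in the `σ^z` basis. -/
abbrev State (N : ℕ) : Type := Config N → ℂ

/-- Linear operators on `(ℂ²)^{⊗ N}`, as matrices in the `σ^z` basis. -/
abbrev Op (N : ℕ) : Type := Matrix (Config N) (Config N) ℂ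

/-- The Pauli matrix `σ^x`. -/
def pauliX : Matrix (Fin 2) (Fin 2) ℂ := !![0, 1; 1, 0]

/-- The Pauli matrix `σ^y`. -/
def pauliY : Matrix (Fin 2) (Fin 2) ℂ := !![0, -Complex.I; Complex.I, 0]

/-- The Pauli matrix `σ^z`. -/
def pauliZ : Matrix (Fin 2) (Fin 2) ℂ := !![1, 0; 0, -1]

/-- The operator `1 ⊗ ⋯ ⊗ A ⊗ ⋯ ⊗ 1` with `A` at the site `j`. -/
def siteOp {N : ℕ} (A : Matrix (Fin 2) (Fin 2) ℂ) (j : Fin N) : Op N :=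
  Matrix.of fun s t => if ∀ k, k ≠ j → s k = t k then A (s j) (t j) else 0

/-- The parity operator `Π^x = ∏_j σ_j^x`. -/
def parityX (N : ℕ) : Op N := (List.ofFn fun j : Fin N => siteOp pauliX j).prod

/-- The cluster term `σ_j^y (σ_{j+1}^z ⋯ σ_{j+n}^z) σ_{j+n+1}^y`. -/
def clusterTerm (N n : ℕ) [NeZero N] (j : Fin N) : Op N :=
  siteOp pauliY j *
    (List.ofFn fun k : Fin n => siteOp pauliZ (j + Fin.ofNat N (k.val + 1))).prod *
    siteOp pauliY (j + Fin.ofNat N (n + 1))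

/-- The `n`-Cluster-Ising Hamiltonian
`H = ∑_j σ_j^x σ_{j+1}^x + lam ∑_j σ_j^y (σ_{j+1}^z ⋯ σ_{j+n}^z) σ_{j+n+1}^y`. -/
def hamiltonian (N n : ℕ) [NeZero N] (lam : ℝ) : Op N :=
  (∑ j : Fin N, siteOp pauliX j * siteOp pauliX (j + Fin.ofNat N 1)) +
    (lam : ℂ) • ∑ j : Fin N, clusterTerm N n j

/-- The energy levels: the real eigenvalues of an operator. -/
def energyLevels {N : ℕ} (H : Op N) : Set ℝ :=
  {E : ℝ | Module.End.HasEigenvalue (Matrix.toLin' H) (E : ℂ)}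

/-- The lowest energy level. -/
def groundEnergy {N : ℕ} (H : Op N) : ℝ := sInf (energyLevels H)

/-- The ground space: the eigenspace of the lowest energy level. -/
def groundSpace {N : ℕ} (H : Op N) : Submodule ℂ (State N) :=
  Module.End.eigenspace (Matrix.toLin' H) (groundEnergy H : ℂ)

/-- The lattice translation by one site, `T |s_1, s_2, …, s_N⟩ = |s_2, …, s_N, s_1⟩`, so that
`T† σ_j T = σ_{j+1}`. -/
def translation (N : ℕ) [NeZero N] : Op N :=
  Matrix.of fun s t => if ∀ j, s j = t (j + Fin.ofNat N 1) then 1 else 0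

/-- The Jordan-Wigner fermion `c_j = (⊗_{l<j} σ_l^z) (σ_j^x + i σ_j^y) / 2`. -/
def jordanWigner {N : ℕ} (j : Fin N) : Op N :=
  (List.ofFn fun l : Fin j.val => siteOp pauliZ (l.castLE j.isLt.le)).prod *
    ((1 / 2 : ℂ) • (siteOp pauliX j + Complex.I • siteOp pauliY j))

/-- The Fourier transformed fermion `b_q = N^{-1/2} ∑_{j=1}^N c_j e^{-iqj}`. -/
def fourierMode (N : ℕ) (q : ℝ) : Op N :=
  (1 / (Real.sqrt N : ℂ)) •
    ∑ j : Fin N, Complex.exp (-(Complex.I * q * ((j.val : ℂ) + 1))) • jordanWigner j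

/-- The Bogoliubov angle in `(-π/2, π/2]`, determined by
`e^{2iθ_q} = e^{iq} (1 + lam e^{-i(n+2)q}) / |1 + lam e^{-i(n+2)q}|`. -/
def bogoliubovAngle (n : ℕ) (lam q : ℝ) : ℝ :=
  Complex.arg (Complex.exp (Complex.I * q) *
    (1 + lam * Complex.exp (-(Complex.I * ((n : ℂ) + 2) * q)))) / 2

open Classical in
/-- The Bogoliubov fermion `a_q = cos θ_q b_q + i sin θ_q b_{-q}†` for `q ≠ 0, π`, and
`a_q = b_q` for `q = 0, π`. -/
def bogoliubovMode (N n : ℕ) (lam q : ℝ) : Op N :=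
  if q = 0 ∨ q = Real.pi then fourierMode N q
  else (Real.cos (bogoliubovAngle n lam q) : ℂ) • fourierMode N q +
    (Complex.I * (Real.sin (bogoliubovAngle n lam q) : ℂ)) • (fourierMode N (-q))ᴴ

/-- The momenta `Γ⁻ = {2πk/N : k = 0, …, N-1}` of the sector `Π^z = -1`. -/
def momenta (N : ℕ) : Set ℝ := {q | ∃ k : ℕ, k < N ∧ q = 2 * Real.pi * k / N}

/-- The state `|↑↑⋯↑⟩`. -/
def allUp (N : ℕ) : State N := Pi.single (fun _ => 0) 1

/-- The Bogoliubov vacuum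
`|0⁻⟩ = ∏_{0<q<π, q∈Γ⁻} (cos θ_q - i sin θ_q b_q† b_{-q}†) |↑↑⋯↑⟩`. For odd `N` the momenta
`q ∈ Γ⁻` with `0 < q < π` are `q = 2πk/N` with `1 ≤ k ≤ (N-1)/2`. The factors commute. -/
def vacuum (N n : ℕ) (lam : ℝ) : State N :=
  (List.ofFn fun k : Fin ((N - 1) / 2) =>
    let q : ℝ := 2 * Real.pi * (k.val + 1 : ℕ) / N
    (Real.cos (bogoliubovAngle n lam q) : ℂ) • (1 : Op N) -
      (Complex.I * (Real.sin (bogoliubovAngle n lam q) : ℂ)) •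
        ((fourierMode N q)ᴴ * (fourierMode N (-q))ᴴ)).prod *ᵥ allUp N

/-- The single-mode state `a_q† |0⁻⟩`. -/
def singleMode (N n : ℕ) (lam q : ℝ) : State N :=
  (bogoliubovMode N n lam q)ᴴ *ᵥ vacuum N n lam

open Classical in
/-- The energy `ε_q` of the mode `q ∈ Γ⁻`: `2 |1 + lam e^{i(n+2)q}|` for `q ≠ 0` and
`ε_0 = 2 (1 + lam)`. -/
def modeEnergy (n : ℕ) (lam q : ℝ) : ℝ :=
  if q = 0 then 2 * (1 + lam)
  else 2 * ‖(1 : ℂ) + lam * Complex.exp (Complex.I * ((n : ℂ) + 2) * q)‖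

/-- The momenta `q ∈ Γ⁻` of minimal energy `ε_q`. -/
def groundMomenta (N n : ℕ) (lam : ℝ) : Set ℝ :=
  {q | q ∈ momenta N ∧ ∀ p ∈ momenta N, modeEnergy n lam q ≤ modeEnergy n lam p}

/-- The states `a_q† |0⁻⟩` and `Π^x a_q† |0⁻⟩` for the momenta `q` of minimal energy. -/
def groundFamily (N n : ℕ) (lam : ℝ) : groundMomenta N n lam ⊕ groundMomenta N n lam → State N :=
  Sum.elim (fun q => singleMode N n lam q) (fun q => parityX N *ᵥ singleMode N n lam q)

end ClusterIsing

end

noncomputable section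

set_option linter.unusedSectionVars false

namespace ClusterIsing

/-! ### Site operators, strings of `σ^z`, and Jordan-Wigner operators. -/

section

open Matrix

variable {N : ℕ}

/-! Only the sector `Π^z = -1` has to be diagonalized. Since `N` is odd, `Π^x` anticommutes with
`Π^z`, and since `n` is even it commutes with `H`; so `Π^x` carries the odd sector isomorphically
onto the even one, and every level is doubled.

On odd states the Jordan-Wigner boundary term has the sign that makes the fermions periodic. This is
proved through the translation: on odd states it shifts a product of two Jordan-Wigner operators
cyclically (`jw_jw_translation`), so each term of `H` is known from the term at site `0`, which does
not cross the seam (`hamiltonian_mulVec_of_odd`). The resulting quadratic form has Fourier symbol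
`e^{iq}(1 + λ e^{-i(n+2)q})`, and the Bogoliubov rotation by half its argument gives `∑ ε_q (a_q†
a_q - 1/2)` (`oddHamiltonian_eq`).

The vacuum is built from the all-up state one pair `(q, -q)` at a time (`IsPartialVacuum`). All
modes annihilate it, and it has even parity. The `2^N` Fock states over it are independent, hence a
basis of the whole space; those with an odd number of particles, together with their images under
`Π^x`, form an eigenbasis of `H` (`CAR.linearIndependent_oddFockFamily`, `CAR.span_oddFockFamily`).
Here lies the frustration: the vacuum has the wrong parity, so at least one particle is present. For
`|λ| < 1` all `ε_q` are positive, so the lowest states carry exactly one particle, at a momentum of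
minimal energy, and the degeneracy is `2 |Q|` (`isLeast_groundEnergy_and_span`,
`finrank_groundSpace`).

It remains to count `Q`. As `ε_q² = 4(1 + λ² + 2λ cos((n+2)q))`, one maximizes the cosine for `λ <
0` and minimizes it for `λ > 0`. Write `N = g(2h+1)` and `n+2 = gm` with `m` prime to `2h+1`; then
`(n+2)q = 2π mk/(2h+1)`. The maximum is at `mk ≡ 0`, the minimum at `mk ≡ h` or `h+1` modulo `2h+1`,
and each such class contains `g` of the `N` values of `k`. -/

theorem op_ext {M M' : Op N} (h : ∀ ψ s, (M *ᵥ ψ) s = (M' *ᵥ ψ) s) : M = M' :=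
  Matrix.ext_of_mulVec_single fun _ => funext fun s => h _ s

/-- Only configurations that agree with `s` off `j` contribute, so the sum over all configurations
collapses to two terms. Many operator identities below are checked on wave functions through this
formula. -/
theorem siteOp_mulVec (A : Matrix (Fin 2) (Fin 2) ℂ) (j : Fin N) (ψ : State N) (s : Config N) :
    (siteOp A j *ᵥ ψ) s = ∑ a, A (s j) a * ψ (Function.update s j a) := by
  symm
  simp only [mulVec, dotProduct]
  refine Fintype.sum_of_injective (fun a => Function.update s j a)
    (Function.update_injective s j) _ _ ?_ ?_
  · intro t ht
    have : ¬ ∀ k, k ≠ j → s k = t k := by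
      intro h
      refine ht ⟨t j, funext fun k => ?_⟩
      by_cases hk : k = j
      · subst hk; simp
      · simp [hk, h k hk]
    simp only [siteOp, of_apply, if_neg this, zero_mul]
  · intro a
    have : ∀ k, k ≠ j → s k = Function.update s j a k := fun k hk => by simp [hk]
    simp only [siteOp, of_apply, if_pos this, Function.update_self]

theorem siteOp_mul_same (A B : Matrix (Fin 2) (Fin 2) ℂ) (j : Fin N) :
    siteOp A j * siteOp B j = siteOp (A * B) j := by
  refine op_ext fun ψ s => ?_
  rw [← mulVec_mulVec]
  simp only [siteOp_mulVec, Function.update_self, Function.update_idem, Matrix.mul_apply,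
    Fin.sum_univ_two]
  ring

theorem siteOp_comm {i j : Fin N} (h : i ≠ j) (A B : Matrix (Fin 2) (Fin 2) ℂ) :
    siteOp A i * siteOp B j = siteOp B j * siteOp A i := by
  refine op_ext fun ψ s => ?_
  rw [← mulVec_mulVec, ← mulVec_mulVec]
  simp only [siteOp_mulVec, Function.update_of_ne h, Function.update_of_ne h.symm,
    Fin.sum_univ_two, Function.update_comm h]
  ring

theorem siteOp_one (j : Fin N) : siteOp 1 j = (1 : Op N) := by
  refine op_ext fun ψ s => ?_
  rw [siteOp_mulVec, Finset.sum_eq_single (s j)]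
  · simp
  · intro b _ hb
    simp [hb.symm]
  · simp

theorem siteOp_add (A B : Matrix (Fin 2) (Fin 2) ℂ) (j : Fin N) :
    siteOp (A + B) j = siteOp A j + siteOp B j := by
  ext s t
  simp only [siteOp, of_apply, Matrix.add_apply]
  split_ifs <;> simp

theorem siteOp_smul (c : ℂ) (A : Matrix (Fin 2) (Fin 2) ℂ) (j : Fin N) :
    siteOp (c • A) j = c • siteOp A j := by
  ext s t
  simp only [siteOp, of_apply, Matrix.smul_apply]
  split_ifs <;> simp

theorem siteOp_conjTranspose (A : Matrix (Fin 2) (Fin 2) ℂ) (j : Fin N) :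
    (siteOp A j)ᴴ = siteOp Aᴴ j := by
  ext s t
  simp only [siteOp, of_apply, conjTranspose_apply, eq_comm (a := t _)]
  split_ifs <;> simp

/-- The eigenvalue of `σ^z` on a basis vector. -/
def zsign (a : Fin 2) : ℂ := if a = 0 then 1 else -1

theorem zsign_mul_self (a : Fin 2) : zsign a * zsign a = 1 := by
  unfold zsign; split_ifs <;> simp

theorem zsign_add_one (a : Fin 2) : zsign (a + 1) = -zsign a := by
  fin_cases a <;> simp [zsign]

/-- The string `∏_{l ∈ S} σ_l^z`. -/
def zString (S : Finset (Fin N)) : Op N := diagonal fun s => ∏ l ∈ S, zsign (s l)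

theorem zString_mulVec (S : Finset (Fin N)) (ψ : State N) (s : Config N) :
    (zString S *ᵥ ψ) s = (∏ l ∈ S, zsign (s l)) * ψ s := by
  rw [zString, mulVec_diagonal]

/-- The factors `σ^z` square to one, so those at common sites cancel. -/
theorem zString_mul (S S' : Finset (Fin N)) : zString S * zString S' = zString (symmDiff S S') := by
  rw [zString, zString, zString, diagonal_mul_diagonal]
  congr 1
  funext s
  simp only [← Fintype.prod_ite_mem _ fun l => zsign (s l), ← Finset.prod_mul_distrib]
  refine Finset.prod_congr rfl fun l _ => ?_
  by_cases h : l ∈ S <;> by_cases h' : l ∈ S' <;> simp [Finset.mem_symmDiff, h, h', zsign_mul_self]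

theorem zString_mul_self (S : Finset (Fin N)) : zString S * zString S = 1 := by
  rw [zString_mul, symmDiff_self]
  simp [zString]

theorem zString_comm (S S' : Finset (Fin N)) : zString S * zString S' = zString S' * zString S := by
  rw [zString_mul, zString_mul, symmDiff_comm]

theorem zString_conjTranspose (S : Finset (Fin N)) : (zString S)ᴴ = zString S := by
  rw [zString, diagonal_conjTranspose]
  congr 1
  funext s
  simp only [Pi.star_apply, star_prod]
  refine Finset.prod_congr rfl fun l _ => ?_
  unfold zsign; split_ifs <;> simp

theorem zString_singleton (j : Fin N) : zString {j} = siteOp pauliZ j := by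
  refine op_ext fun ψ s => ?_
  rw [siteOp_mulVec, zString_mulVec, Finset.sum_eq_single (s j)]
  · rcases Fin.exists_fin_two.mp ⟨s j, rfl⟩ with h | h <;> simp [← h, pauliZ, zsign]
    all_goals simp [h]
  · intro b _ hb
    have : pauliZ (s j) b = 0 := by
      revert hb
      generalize s j = a
      fin_cases a <;> fin_cases b <;> simp [pauliZ]
    simp [this]
  · simp

theorem zString_insert {j : Fin N} {S : Finset (Fin N)} (h : j ∉ S) :
    zString (insert j S) = siteOp pauliZ j * zString S := by
  rw [← zString_singleton, zString_mul]
  congr 1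
  ext x
  simp only [Finset.mem_insert, Finset.mem_symmDiff, Finset.mem_singleton]
  by_cases hx : x = j
  · subst hx; simp [h]
  · simp [hx]

theorem prod_siteOp_pauliZ {L : List (Fin N)} (hL : L.Nodup) :
    (L.map (siteOp pauliZ)).prod = zString L.toFinset := by
  induction L with
  | nil => simp [zString]
  | cons a L ih =>
    rw [List.nodup_cons] at hL
    rw [List.map_cons, List.prod_cons, List.toFinset_cons,
      zString_insert (by simpa using hL.1), ih hL.2]

/-- Matrices that flip the spin. -/
def OffDiagonal (P : Matrix (Fin 2) (Fin 2) ℂ) : Prop := P 0 0 = 0 ∧ P 1 1 = 0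

theorem offDiagonal_pauliX : OffDiagonal pauliX := by simp [OffDiagonal, pauliX]

theorem offDiagonal_pauliY : OffDiagonal pauliY := by simp [OffDiagonal, pauliY]

theorem OffDiagonal.conjTranspose {P : Matrix (Fin 2) (Fin 2) ℂ} (hP : OffDiagonal P) :
    OffDiagonal Pᴴ := by
  simp [OffDiagonal, hP.1, hP.2]

theorem prod_zsign_update_of_notMem {S : Finset (Fin N)} {j : Fin N} (h : j ∉ S) (s : Config N)
    (a : Fin 2) : ∏ l ∈ S, zsign (Function.update s j a l) = ∏ l ∈ S, zsign (s l) :=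
  Finset.prod_congr rfl fun l hl => by
    rw [Function.update_of_ne (ne_of_mem_of_not_mem hl h)]

theorem siteOp_mul_zString_of_notMem {S : Finset (Fin N)} {j : Fin N} (h : j ∉ S)
    (P : Matrix (Fin 2) (Fin 2) ℂ) : siteOp P j * zString S = zString S * siteOp P j := by
  refine op_ext fun ψ s => ?_
  rw [← mulVec_mulVec, ← mulVec_mulVec]
  simp only [siteOp_mulVec, zString_mulVec, prod_zsign_update_of_notMem h, Finset.mul_sum]
  exact Finset.sum_congr rfl fun a _ => by ring

theorem siteOp_mul_pauliZ {P : Matrix (Fin 2) (Fin 2) ℂ} (hP : OffDiagonal P) :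
    P * pauliZ = (-1 : ℂ) • (pauliZ * P) := by
  ext a b
  fin_cases a <;> fin_cases b <;> simp [pauliZ, Matrix.mul_apply, Fin.sum_univ_two, hP.1, hP.2, -cons_mul]

/-- A spin flip anticommutes with the one factor `σ^z` at its own site and commutes with the rest of
the string. -/
theorem siteOp_mul_zString_of_mem {S : Finset (Fin N)} {j : Fin N} (h : j ∈ S)
    {P : Matrix (Fin 2) (Fin 2) ℂ} (hP : OffDiagonal P) :
    siteOp P j * zString S = -(zString S * siteOp P j) := by
  rw [← Finset.insert_erase h, zString_insert (Finset.notMem_erase j S), ← mul_assoc,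
    siteOp_mul_same, siteOp_mul_pauliZ hP, siteOp_smul, ← siteOp_mul_same, mul_assoc _ _ (siteOp P j),
    ← siteOp_mul_zString_of_notMem (Finset.notMem_erase j S)]
  simp [mul_assoc]

/-- Jordan-Wigner operators: `P` at the site `j` with a string of `σ^z` on the sites before. -/
def jw (P : Matrix (Fin 2) (Fin 2) ℂ) (j : Fin N) : Op N := zString (Finset.Iio j) * siteOp P j

theorem jw_add (P Q : Matrix (Fin 2) (Fin 2) ℂ) (j : Fin N) : jw (P + Q) j = jw P j + jw Q j := by
  rw [jw, siteOp_add, mul_add]; rfl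

theorem jw_smul (c : ℂ) (P : Matrix (Fin 2) (Fin 2) ℂ) (j : Fin N) : jw (c • P) j = c • jw P j := by
  rw [jw, siteOp_smul, Matrix.mul_smul]; rfl

theorem jw_conjTranspose (P : Matrix (Fin 2) (Fin 2) ℂ) (j : Fin N) : (jw P j)ᴴ = jw Pᴴ j := by
  rw [jw, conjTranspose_mul, siteOp_conjTranspose, zString_conjTranspose,
    siteOp_mul_zString_of_notMem (by simp)]
  rfl

theorem jw_mul_same (P Q : Matrix (Fin 2) (Fin 2) ℂ) (j : Fin N) :
    jw P j * jw Q j = siteOp (P * Q) j := by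
  rw [jw, jw, mul_assoc, ← mul_assoc (siteOp P j),
    siteOp_mul_zString_of_notMem (by simp), ← mul_assoc, ← mul_assoc, zString_mul_self, one_mul,
    siteOp_mul_same]

theorem jw_mul_zString_of_notMem {S : Finset (Fin N)} {j : Fin N} (h : j ∉ S)
    (P : Matrix (Fin 2) (Fin 2) ℂ) : jw P j * zString S = zString S * jw P j := by
  rw [jw, mul_assoc, siteOp_mul_zString_of_notMem h, ← mul_assoc, ← mul_assoc, zString_comm]

theorem jw_mul_zString_of_mem {S : Finset (Fin N)} {j : Fin N} (h : j ∈ S)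
    {P : Matrix (Fin 2) (Fin 2) ℂ} (hP : OffDiagonal P) :
    jw P j * zString S = -(zString S * jw P j) := by
  rw [jw, mul_assoc, siteOp_mul_zString_of_mem h hP, mul_neg, ← mul_assoc, ← mul_assoc,
    zString_comm]

/-- The string of the operator at `j` passes through `i` and yields one sign; the string of the
operator at `i` does not reach `j`, which is why `Q` may be arbitrary. -/
theorem jw_anticomm_of_lt {i j : Fin N} (h : i < j) {P Q : Matrix (Fin 2) (Fin 2) ℂ}
    (hP : OffDiagonal P) : jw P i * jw Q j = -(jw Q j * jw P i) := by
  conv_lhs => rw [jw.eq_def Q, ← mul_assoc, jw_mul_zString_of_mem (by simpa using h) hP, jw.eq_def P]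
  conv_rhs => rw [jw.eq_def Q, mul_assoc, jw, ← mul_assoc (siteOp Q j),
    siteOp_mul_zString_of_notMem (by simpa using h.le), mul_assoc _ (siteOp Q j),
    siteOp_comm h.ne']
  simp only [neg_mul, mul_assoc]

theorem jw_anticomm {i j : Fin N} (h : i ≠ j) {P Q : Matrix (Fin 2) (Fin 2) ℂ}
    (hP : OffDiagonal P) (hQ : OffDiagonal Q) : jw P i * jw Q j = -(jw Q j * jw P i) := by
  rcases lt_or_gt_of_ne h with h | h
  · exact jw_anticomm_of_lt h hP
  · rw [jw_anticomm_of_lt h hQ, neg_neg]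

theorem jordanWigner_eq (j : Fin N) :
    jordanWigner j = jw ((1 / 2 : ℂ) • (pauliX + Complex.I • pauliY)) j := by
  rw [jordanWigner, jw, siteOp_smul, siteOp_add, siteOp_smul]
  congr 1
  have : (List.ofFn fun l : Fin j.val => siteOp pauliZ (l.castLE j.isLt.le)) =
      (List.ofFn fun l : Fin j.val => l.castLE j.isLt.le).map (siteOp pauliZ) := by
    rw [List.map_ofFn]; rfl
  rw [this, prod_siteOp_pauliZ (List.nodup_ofFn.mpr (Fin.castLE_injective _))]
  congr 1
  ext x
  simp only [List.mem_toFinset, List.mem_ofFn, Finset.mem_Iio]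
  constructor
  · rintro ⟨l, rfl⟩
    exact l.isLt
  · intro h
    exact ⟨⟨x, h⟩, rfl⟩

end

/-! ### The parity `Π^z`, the translation, and periodic fermions on odd states. -/

section

open Matrix

variable {N : ℕ}

/-- The parity operator `Π^z`. -/
def parityZ (N : ℕ) : Op N := zString Finset.univ

theorem parityZ_mul_self : parityZ N * parityZ N = 1 := zString_mul_self _

theorem jw_mul_parityZ {P : Matrix (Fin 2) (Fin 2) ℂ} (hP : OffDiagonal P) (j : Fin N) :
    jw P j * parityZ N = -(parityZ N * jw P j) :=
  jw_mul_zString_of_mem (Finset.mem_univ j) hP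

theorem parityZ_mulVec_jw {P : Matrix (Fin 2) (Fin 2) ℂ} (hP : OffDiagonal P) (j : Fin N)
    (ψ : State N) : parityZ N *ᵥ (jw P j *ᵥ ψ) = -(jw P j *ᵥ (parityZ N *ᵥ ψ)) := by
  rw [mulVec_mulVec, mulVec_mulVec, jw_mul_parityZ hP, neg_mulVec, neg_neg]

/-- The parity picked up by a Jordan-Wigner operator at the end of the chain. -/
def boundaryParity (j : Fin N) : Op N := if j.val + 1 = N then parityZ N else 1

theorem boundaryParity_mulVec (j : Fin N) {φ : State N} (hφ : parityZ N *ᵥ φ = φ) :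
    boundaryParity j *ᵥ φ = φ := by
  unfold boundaryParity
  split_ifs
  · exact hφ
  · exact one_mulVec φ

section Translation

variable [NeZero N]

theorem translation_mulVec (ψ : State N) (s : Config N) :
    (translation N *ᵥ ψ) s = ψ fun j => s (j - Fin.ofNat N 1) := by
  simp only [mulVec, dotProduct, translation, of_apply]
  rw [Finset.sum_eq_single fun j => s (j - Fin.ofNat N 1)]
  · simp
  · intro t _ ht
    rw [if_neg, zero_mul]
    intro h
    refine ht (funext fun j => ?_)
    rw [h, sub_add_cancel]
  · simp

theorem translation_injective {ψ φ : State N} (h : translation N *ᵥ ψ = translation N *ᵥ φ) :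
    ψ = φ := by
  funext t
  have := congrFun h fun j => t (j + Fin.ofNat N 1)
  simpa [translation_mulVec] using this

theorem siteOp_mul_translation (P : Matrix (Fin 2) (Fin 2) ℂ) (j : Fin N) :
    siteOp P j * translation N = translation N * siteOp P (j + Fin.ofNat N 1) := by
  refine op_ext fun ψ s => ?_
  rw [← mulVec_mulVec, ← mulVec_mulVec]
  simp only [siteOp_mulVec, translation_mulVec, add_sub_cancel_right]
  refine Finset.sum_congr rfl fun a _ => ?_
  congr 2
  funext l
  simp only [Function.update_apply, sub_eq_iff_eq_add]

theorem zString_mul_translation {S S' : Finset (Fin N)}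
    (h : ∀ l, l ∈ S ↔ l + Fin.ofNat N 1 ∈ S') :
    zString S * translation N = translation N * zString S' := by
  refine op_ext fun ψ s => ?_
  rw [← mulVec_mulVec, ← mulVec_mulVec]
  simp only [zString_mulVec, translation_mulVec]
  congr 1
  rw [← Fintype.prod_ite_mem, ← Fintype.prod_ite_mem S']
  refine Eq.trans (Finset.prod_congr rfl fun l _ => ?_)
    (Equiv.prod_comp (Equiv.addRight (Fin.ofNat N 1)) _)
  simp [h l]

theorem parityZ_mul_translation : parityZ N * translation N = translation N * parityZ N :=
  zString_mul_translation fun l => by simp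

theorem val_add_ofNat_one (j : Fin N) :
    ((j + Fin.ofNat N 1 : Fin N) : ℕ) = if j.val + 1 = N then 0 else j.val + 1 := by
  rw [Fin.val_add, Fin.val_ofNat, Nat.add_mod_mod]
  split_ifs with h
  · rw [h, Nat.mod_self]
  · exact Nat.mod_eq_of_lt (by have := j.isLt; omega)

/-- Translation turns the string on the sites before `j` into one on the sites up to `j` without
site `0`. Compared with the string belonging to `j + 1` it lacks `σ^z_0`. At the last site, `j + 1`
is `0` with an empty string, while the translated string covers all sites but `0`, which accounts
for the extra `Π^z`. -/
theorem jw_mul_translation (P : Matrix (Fin 2) (Fin 2) ℂ) (j : Fin N) :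
    jw P j * translation N =
      translation N * (zString {0} * boundaryParity j * jw P (j + Fin.ofNat N 1)) := by
  have key : zString {0} * boundaryParity j * zString (Finset.Iio (j + Fin.ofNat N 1)) =
      zString ((Finset.Iio j).map (Equiv.addRight (Fin.ofNat N 1)).toEmbedding) := by
    have hmem : ∀ x : Fin N,
        x ∈ (Finset.Iio j).map (Equiv.addRight (Fin.ofNat N 1)).toEmbedding ↔
          x ≠ 0 ∧ x.val < j.val + 1 := by
      intro x
      simp only [Finset.mem_map_equiv, Finset.mem_Iio, Equiv.addRight_symm, Equiv.coe_addRight,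
        ← sub_eq_add_neg, Fin.lt_def, ne_eq, Fin.ext_iff, Fin.val_zero]
      have h := val_add_ofNat_one (x - Fin.ofNat N 1)
      rw [sub_add_cancel] at h
      have := (x - Fin.ofNat N 1).isLt
      have := j.isLt
      split_ifs at h <;> omega
    have hv := val_add_ofNat_one j
    unfold boundaryParity
    split_ifs at hv ⊢ with h
    · rw [parityZ, zString_mul, zString_mul]
      congr 1
      ext x
      rw [hmem]
      simp only [Finset.mem_symmDiff, Finset.mem_singleton, Finset.mem_univ, Finset.mem_Iio,
        Fin.lt_def, hv, Fin.ext_iff, Fin.val_zero, ne_eq]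
      have hx' : x.val < j.val + 1 := x.isLt.trans_eq h.symm
      by_cases hx : x.val = 0 <;> simp [hx, hx']
    · rw [mul_one, zString_mul]
      congr 1
      ext x
      rw [hmem]
      simp only [Finset.mem_symmDiff, Finset.mem_singleton, Finset.mem_Iio,
        Fin.lt_def, hv, Fin.ext_iff, Fin.val_zero, ne_eq]
      by_cases hx : x.val = 0 <;> simp [hx]
  rw [jw, jw, mul_assoc, siteOp_mul_translation, ← mul_assoc, ← mul_assoc (_ * _), key,
    ← mul_assoc, zString_mul_translation]
  intro l
  simp

/-- Away from the seam the two factors `σ^z_0` cancel. At the seam two signs arise, from moving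
`σ^z_0` and from moving `Π^z` past the operator at site `0`, and they cancel on an even vector. -/
theorem zString_zero_conj_jw {P : Matrix (Fin 2) (Fin 2) ℂ} (hP : OffDiagonal P) (j : Fin N)
    {φ : State N} (hφ : parityZ N *ᵥ φ = φ) :
    (zString {0} * boundaryParity j * jw P (j + Fin.ofNat N 1)) *ᵥ (zString {0} *ᵥ φ) =
      jw P (j + Fin.ofNat N 1) *ᵥ φ := by
  have hv := val_add_ofNat_one j
  unfold boundaryParity
  split_ifs at hv ⊢ with h
  · have h0 : (j + Fin.ofNat N 1 : Fin N) = 0 := by rw [Fin.ext_iff, hv, Fin.val_zero]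
    have hc : zString {0} * parityZ N = parityZ N * zString {0} := zString_comm _ _
    rw [h0, mulVec_mulVec, mul_assoc, jw_mul_zString_of_mem (by simp) hP, hc, mul_neg, mul_assoc,
      ← mul_assoc (zString {0}), zString_mul_self, one_mul, ← jw_mul_parityZ hP, ← mulVec_mulVec]
    exact congrArg _ hφ
  · have h0 : (j + Fin.ofNat N 1 : Fin N) ∉ ({0} : Finset (Fin N)) := by
      rw [Finset.mem_singleton, Fin.ext_iff, hv, Fin.val_zero]; omega
    rw [mulVec_mulVec, mul_one, mul_assoc, jw_mul_zString_of_notMem h0, ← mul_assoc,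
      zString_mul_self, one_mul]

/-- On states of odd fermion number the translation shifts products of two Jordan-Wigner operators
cyclically. -/
theorem jw_jw_translation {P Q : Matrix (Fin 2) (Fin 2) ℂ} (hP : OffDiagonal P)
    (hQ : OffDiagonal Q) (i j : Fin N) {ψ : State N} (hψ : parityZ N *ᵥ ψ = -ψ) :
    (jw P i * jw Q j) *ᵥ (translation N *ᵥ ψ) =
      translation N *ᵥ ((jw P (i + Fin.ofNat N 1) * jw Q (j + Fin.ofNat N 1)) *ᵥ ψ) := by
  -- The operator that acts first makes the odd vector even, so its own boundary parity acts
  -- trivially and the other operator meets an even vector.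
  have hφ : parityZ N *ᵥ (jw Q (j + Fin.ofNat N 1) *ᵥ ψ) = jw Q (j + Fin.ofNat N 1) *ᵥ ψ := by
    rw [parityZ_mulVec_jw hQ, hψ, mulVec_neg, neg_neg]
  have h1 : (zString {0} * boundaryParity j * jw Q (j + Fin.ofNat N 1)) *ᵥ ψ =
      zString {0} *ᵥ (jw Q (j + Fin.ofNat N 1) *ᵥ ψ) := by
    rw [← mulVec_mulVec, ← mulVec_mulVec, boundaryParity_mulVec _ hφ]
  rw [← mulVec_mulVec, mulVec_mulVec _ (jw Q j), jw_mul_translation, ← mulVec_mulVec, h1,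
    mulVec_mulVec _ (jw P i), jw_mul_translation, ← mulVec_mulVec, zString_zero_conj_jw hP i hφ,
    ← mulVec_mulVec]

theorem parityZ_mulVec_translation {ψ : State N} (hψ : parityZ N *ᵥ ψ = -ψ) :
    parityZ N *ᵥ (translation N *ᵥ ψ) = -(translation N *ᵥ ψ) := by
  rw [mulVec_mulVec, parityZ_mul_translation, ← mulVec_mulVec, hψ, mulVec_neg]

/-- If an operator family is shifted by the translation, and its first member acts on odd states as
a product of two Jordan-Wigner operators, then so does each member. -/
theorem mulVec_eq_jw_jw_of_translation {O : Fin N → Op N}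
    (hO : ∀ j, O j * translation N = translation N * O (j + Fin.ofNat N 1))
    {P Q : Matrix (Fin 2) (Fin 2) ℂ} (hP : OffDiagonal P) (hQ : OffDiagonal Q) (d : Fin N) (c : ℂ)
    (h0 : O 0 = c • (jw P 0 * jw Q (0 + d))) (j : Fin N) {ψ : State N}
    (hψ : parityZ N *ᵥ ψ = -ψ) : O j *ᵥ ψ = c • ((jw P j * jw Q (j + d)) *ᵥ ψ) := by
  suffices h : ∀ (x : ℕ) {ψ : State N}, parityZ N *ᵥ ψ = -ψ →
      O (Fin.ofNat N x) *ᵥ ψ =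
        c • ((jw P (Fin.ofNat N x) * jw Q (Fin.ofNat N x + d)) *ᵥ ψ) by
    simpa using h j.val hψ
  intro x
  induction x with
  | zero =>
    intro ψ hψ
    rw [show Fin.ofNat N 0 = 0 from rfl, h0, smul_mulVec]
  | succ x ih =>
    intro ψ hψ
    have hx : Fin.ofNat N (x + 1) = Fin.ofNat N x + Fin.ofNat N 1 := by
      ext; simp [Fin.val_add]
    -- After `T` is applied to both sides, the member at `x + 1` becomes the member at `x` acting on
    -- `T ψ`, which is odd again.
    apply translation_injective
    rw [hx, mulVec_mulVec, ← hO, ← mulVec_mulVec, ih (parityZ_mulVec_translation hψ),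
      jw_jw_translation hP hQ _ _ hψ, mulVec_smul, add_right_comm]

theorem clusterTerm_mul_translation (n : ℕ) (j : Fin N) :
    clusterTerm N n j * translation N =
      translation N * clusterTerm N n (j + Fin.ofNat N 1) := by
  have hl : ∀ L : List (Fin N), (L.map (siteOp pauliZ)).prod * translation N =
      translation N * (L.map fun l => siteOp pauliZ (l + Fin.ofNat N 1)).prod := by
    intro L
    induction L with
    | nil => simp
    | cons a L ih =>
      rw [List.map_cons, List.map_cons, List.prod_cons, List.prod_cons, mul_assoc, ih, ← mul_assoc,
        siteOp_mul_translation, mul_assoc]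
  have := hl (List.ofFn fun k : Fin n => j + Fin.ofNat N (k.val + 1))
  rw [List.map_ofFn, List.map_ofFn] at this
  unfold clusterTerm
  rw [mul_assoc, siteOp_mul_translation, ← mul_assoc, mul_assoc (siteOp pauliY j)]
  erw [this]
  rw [← mul_assoc, siteOp_mul_translation, add_right_comm]
  simp only [mul_assoc, Function.comp_def, add_right_comm]

/-- The term at site `0` does not wrap around. The string of the operator at `n + 1` consists of the
`n` cluster sites and site `0`, and its factor at `0` is absorbed by `σ^y = i σ^x σ^z`. -/
theorem clusterTerm_zero {n : ℕ} (hn : n + 2 < N) :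
    clusterTerm N n 0 = Complex.I • (jw pauliX 0 * jw pauliY (0 + Fin.ofNat N (n + 1))) := by
  have hnd : (List.ofFn fun k : Fin n => (0 : Fin N) + Fin.ofNat N (k.val + 1)).Nodup := by
    rw [List.nodup_ofFn]
    intro k l h
    have := congrArg Fin.val h
    simp only [zero_add, Fin.val_ofNat] at this
    rw [Nat.mod_eq_of_lt (by omega), Nat.mod_eq_of_lt (by omega)] at this
    exact Fin.ext (by omega)
  have hp := prod_siteOp_pauliZ hnd
  rw [List.map_ofFn] at hp
  have hiio : (Finset.Iio (0 + Fin.ofNat N (n + 1)) : Finset (Fin N)) =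
      insert 0 (List.ofFn fun k : Fin n => (0 : Fin N) + Fin.ofNat N (k.val + 1)).toFinset := by
    ext x
    simp only [zero_add, Finset.mem_Iio, Fin.lt_def, Fin.val_ofNat, Finset.mem_insert,
      List.mem_toFinset, List.mem_ofFn, Fin.ext_iff, Fin.val_zero]
    rw [Nat.mod_eq_of_lt (by omega)]
    constructor
    · intro h
      by_cases hx : x.val = 0
      · exact Or.inl hx
      · exact Or.inr ⟨⟨x.val - 1, by omega⟩, by
          simp only []
          rw [Nat.mod_eq_of_lt] <;> omega⟩
    · rintro (h | ⟨k, hk⟩)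
      · omega
      · rw [Nat.mod_eq_of_lt (by omega)] at hk
        omega
  have h0 : (0 : Fin N) ∉
      (List.ofFn fun k : Fin n => (0 : Fin N) + Fin.ofNat N (k.val + 1)).toFinset := by
    simp only [zero_add, List.mem_toFinset, List.mem_ofFn, Fin.ext_iff, Fin.val_ofNat, Fin.val_zero,
      not_exists]
    intro k
    rw [Nat.mod_eq_of_lt (by omega)]
    omega
  have hj : jw pauliX (0 : Fin N) = siteOp pauliX 0 := by
    rw [jw, show (Finset.Iio (0 : Fin N)) = ∅ by ext; simp]
    simp [zString]
  have hY : pauliY = Complex.I • (pauliX * pauliZ) := by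
    ext a b
    fin_cases a <;> fin_cases b <;> simp [pauliX, pauliY, pauliZ]
  unfold clusterTerm
  erw [hp]
  rw [hj, jw, hiio, zString_insert h0, ← mul_assoc, ← mul_assoc, siteOp_mul_same, ← smul_mul_assoc,
    ← smul_mul_assoc, ← siteOp_smul, ← hY]

/-- The string of the operator at site `1` is `σ^z_0` alone, absorbed by `σ^x = -i σ^y σ^z`. -/
theorem isingTerm_zero (hN : 2 < N) :
    siteOp pauliX (0 : Fin N) * siteOp pauliX (0 + Fin.ofNat N 1) =
      (-Complex.I) • (jw pauliY 0 * jw pauliX (0 + Fin.ofNat N 1)) := by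
  have hiio : (Finset.Iio (0 + Fin.ofNat N 1) : Finset (Fin N)) = {0} := by
    ext x
    simp only [zero_add, Finset.mem_Iio, Fin.lt_def, Fin.val_ofNat, Finset.mem_singleton,
      Fin.ext_iff, Fin.val_zero]
    rw [Nat.mod_eq_of_lt (by omega)]
    omega
  have hj : jw pauliY (0 : Fin N) = siteOp pauliY 0 := by
    rw [jw, show (Finset.Iio (0 : Fin N)) = ∅ by ext; simp]
    simp [zString]
  have hX : pauliX = (-Complex.I) • (pauliY * pauliZ) := by
    ext a b
    fin_cases a <;> fin_cases b <;> simp [pauliX, pauliY, pauliZ]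
  rw [hj, jw, hiio, zString_singleton, ← mul_assoc, siteOp_mul_same, ← smul_mul_assoc,
    ← siteOp_smul, ← hX]

/-- The fermionic Hamiltonian that agrees with the spin Hamiltonian on odd states. -/
def oddHamiltonian (N n : ℕ) [NeZero N] (lam : ℝ) : Op N :=
  (∑ j : Fin N, (-Complex.I) • (jw pauliY j * jw pauliX (j + Fin.ofNat N 1))) +
    (lam : ℂ) • ∑ j : Fin N, Complex.I • (jw pauliX j * jw pauliY (j + Fin.ofNat N (n + 1)))

theorem hamiltonian_mulVec_of_odd {n : ℕ} (hn : n + 2 < N) (lam : ℝ) {ψ : State N}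
    (hψ : parityZ N *ᵥ ψ = -ψ) :
    hamiltonian N n lam *ᵥ ψ = oddHamiltonian N n lam *ᵥ ψ := by
  unfold hamiltonian oddHamiltonian
  simp only [add_mulVec, smul_mulVec, sum_mulVec]
  congr 1
  · refine Finset.sum_congr rfl fun j _ => ?_
    refine mulVec_eq_jw_jw_of_translation
      (O := fun j => siteOp pauliX j * siteOp pauliX (j + Fin.ofNat N 1)) (fun j => ?_)
      offDiagonal_pauliY offDiagonal_pauliX _ _ (isingTerm_zero (by omega)) j hψ
    rw [mul_assoc, siteOp_mul_translation, ← mul_assoc, siteOp_mul_translation, mul_assoc]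
  · congr 1
    refine Finset.sum_congr rfl fun j _ => ?_
    exact mulVec_eq_jw_jw_of_translation (clusterTerm_mul_translation n)
      offDiagonal_pauliX offDiagonal_pauliY _ _ (clusterTerm_zero hn) j hψ

end Translation

/-! ### The parity `Π^x` and its exchange of the two sectors. -/

section ParityX

theorem siteOp_pauliX_mulVec (j : Fin N) (ψ : State N) :
    siteOp pauliX j *ᵥ ψ = fun s => ψ (Function.update s j (s j + 1)) := by
  funext s
  rw [siteOp_mulVec]
  generalize s j = a
  fin_cases a <;> simp [pauliX]

theorem parityX_mulVec (ψ : State N) : parityX N *ᵥ ψ = fun s => ψ fun k => s k + 1 := by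
  have h : ∀ L : List (Fin N), L.Nodup → (L.map (siteOp pauliX)).prod *ᵥ ψ =
      fun s => ψ fun k => if k ∈ L then s k + 1 else s k := by
    intro L
    induction L with
    | nil => simp
    | cons a L ih =>
      intro hL
      rw [List.nodup_cons] at hL
      rw [List.map_cons, List.prod_cons, ← mulVec_mulVec, ih hL.2, siteOp_pauliX_mulVec]
      funext s
      congr 1
      funext k
      by_cases hk : k = a
      · subst hk; simp [hL.1]
      · simp [hk]
  have := h (List.finRange N) (List.nodup_finRange N)
  unfold parityX
  rw [List.ofFn_eq_map, this]
  simp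

theorem parityX_mul_self : parityX N * parityX N = 1 := by
  refine op_ext fun ψ s => ?_
  rw [← mulVec_mulVec, parityX_mulVec, parityX_mulVec, one_mulVec]
  simp only [add_assoc, show (1 : Fin 2) + 1 = 0 from rfl, add_zero]

/-- Flipping all spins changes the sign of each of the `N` factors `σ^z`, an odd number. -/
theorem parityX_mul_parityZ (hN : Odd N) : parityX N * parityZ N = -(parityZ N * parityX N) := by
  refine op_ext fun ψ s => ?_
  rw [neg_mulVec, Pi.neg_apply, ← mulVec_mulVec, ← mulVec_mulVec]
  simp only [parityX_mulVec, parityZ, zString_mulVec, zsign_add_one, Finset.prod_neg]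
  simp [hN.neg_one_pow]

theorem parityX_mul_translation [NeZero N] :
    parityX N * translation N = translation N * parityX N := by
  refine op_ext fun ψ s => ?_
  rw [← mulVec_mulVec, ← mulVec_mulVec]
  simp only [parityX_mulVec, translation_mulVec]

theorem parityX_mul_siteOp {P Q : Matrix (Fin 2) (Fin 2) ℂ} (h : ∀ a b, P (a + 1) (b + 1) = Q a b)
    (j : Fin N) : parityX N * siteOp P j = siteOp Q j * parityX N := by
  refine op_ext fun ψ s => ?_
  rw [← mulVec_mulVec, ← mulVec_mulVec]
  simp only [parityX_mulVec, siteOp_mulVec, ← h]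
  refine Eq.trans (Equiv.sum_comp (Equiv.addRight (1 : Fin 2))
    fun b => P (s j + 1) b * ψ (Function.update (fun k => s k + 1) j b)).symm
      (Finset.sum_congr rfl fun a _ => ?_)
  simp only [Equiv.coe_addRight]
  congr 2
  funext k
  by_cases hk : k = j
  · subst hk; simp
  · simp [hk]

/-- A cluster term has `n + 2` factors `σ^y` or `σ^z`, each odd under `Π^x`, so it is invariant
because `n` is even. -/
theorem parityX_mul_hamiltonian [NeZero N] {n : ℕ} (hn : Even n) (lam : ℝ) :
    parityX N * hamiltonian N n lam = hamiltonian N n lam * parityX N := by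
  have hX : ∀ j : Fin N, parityX N * siteOp pauliX j = siteOp pauliX j * parityX N :=
    parityX_mul_siteOp fun a b => by fin_cases a <;> fin_cases b <;> simp [pauliX]
  have hY : ∀ j : Fin N, parityX N * siteOp pauliY j = -(siteOp pauliY j * parityX N) := by
    intro j
    rw [parityX_mul_siteOp (Q := (-1 : ℂ) • pauliY)
      (fun a b => by fin_cases a <;> fin_cases b <;> simp [pauliY]), siteOp_smul]
    simp
  have hZ : ∀ j : Fin N, parityX N * siteOp pauliZ j = -(siteOp pauliZ j * parityX N) := by
    intro j
    rw [parityX_mul_siteOp (Q := (-1 : ℂ) • pauliZ)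
      (fun a b => by fin_cases a <;> fin_cases b <;> simp [pauliZ]), siteOp_smul]
    simp
  have hL : ∀ L : List (Fin N), parityX N * (L.map (siteOp pauliZ)).prod =
      (-1 : ℂ) ^ L.length • ((L.map (siteOp pauliZ)).prod * parityX N) := by
    intro L
    induction L with
    | nil => simp
    | cons a L ih =>
      rw [List.map_cons, List.prod_cons, ← mul_assoc, hZ, neg_mul, mul_assoc, ih, List.length_cons,
        pow_succ, mul_neg_one, neg_smul, mul_smul_comm, mul_assoc]
  have hC : ∀ j : Fin N, parityX N * clusterTerm N n j = clusterTerm N n j * parityX N := by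
    intro j
    have := hL (List.ofFn fun k : Fin n => j + Fin.ofNat N (k.val + 1))
    rw [List.map_ofFn, List.length_ofFn, hn.neg_one_pow, one_smul] at this
    unfold clusterTerm
    rw [← mul_assoc, ← mul_assoc, hY, neg_mul, mul_assoc (siteOp pauliY j)]
    erw [this]
    rw [← mul_assoc, neg_mul, mul_assoc _ (parityX N), hY, mul_neg, neg_neg, mul_assoc, mul_assoc,
      mul_assoc]
    rfl
  unfold hamiltonian
  rw [mul_add, add_mul, Finset.mul_sum, Finset.sum_mul, mul_smul_comm, smul_mul_assoc,
    Finset.mul_sum, Finset.sum_mul]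
  congr 1
  · refine Finset.sum_congr rfl fun j _ => ?_
    rw [← mul_assoc, hX, mul_assoc, hX, mul_assoc]
  · congr 1
    exact Finset.sum_congr rfl fun j _ => hC j

end ParityX

end

/-! ### Discrete Fourier phases and the canonical anticommutation relations. -/

section

open Matrix

variable {N : ℕ}

/-- The momentum `2πk/N`. -/
def momentum (k : Fin N) : ℝ := 2 * Real.pi * k.val / N

/-- The phase `e^{iqx}` for `q = 2πk/N`. -/
def phase (k : Fin N) (x : ℤ) : ℂ := Complex.exp (Complex.I * momentum k * x)

theorem phase_add (k : Fin N) (x y : ℤ) : phase k (x + y) = phase k x * phase k y := by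
  rw [phase, phase, phase, ← Complex.exp_add]
  push_cast
  ring_nf

theorem phase_zero (k : Fin N) : phase k 0 = 1 := by simp [phase]

theorem phase_sub (k : Fin N) (x y : ℤ) : phase k (x - y) = phase k x * phase k (-y) := by
  rw [sub_eq_add_neg, phase_add]

theorem star_phase (k : Fin N) (x : ℤ) : star (phase k x) = phase k (-x) := by
  rw [phase, phase, Complex.star_def, ← Complex.exp_conj]
  simp

/-- The exponent is symmetric in site and momentum index, so the orthogonality relation over momenta
also serves for sums over sites. -/
theorem phase_swap (k l : Fin N) : phase k (l.val : ℤ) = phase l (k.val : ℤ) := by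
  simp only [phase, momentum]
  push_cast
  ring_nf

theorem phase_eq_pow (k : Fin N) (x : ℤ) :
    phase k x = Complex.exp (2 * Real.pi * Complex.I * x / N) ^ k.val := by
  rw [phase, momentum, ← Complex.exp_nat_mul]
  push_cast
  ring_nf

section

variable [NeZero N]

theorem natCast_ne_zero' : (N : ℂ) ≠ 0 := Nat.cast_ne_zero.mpr (NeZero.ne N)

theorem phase_of_dvd (k : Fin N) {x : ℤ} (h : (N : ℤ) ∣ x) : phase k x = 1 := by
  obtain ⟨y, rfl⟩ := h
  rw [phase, momentum, Complex.exp_eq_one_iff]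
  refine ⟨k.val * y, ?_⟩
  have := natCast_ne_zero' (N := N)
  push_cast
  field_simp

theorem phase_congr (k : Fin N) {x y : ℤ} (h : (N : ℤ) ∣ x - y) : phase k x = phase k y := by
  rw [← sub_add_cancel x y, phase_add, phase_of_dvd k h, one_mul]

theorem phase_val_add (k j : Fin N) (d : ℕ) :
    phase k ((j + Fin.ofNat N d : Fin N).val : ℤ) = phase k (j.val + d) := by
  refine phase_congr k ?_
  rw [Fin.val_add, Fin.val_ofNat, Nat.add_mod_mod]
  push_cast
  exact (Int.mod_modEq _ _).symm.dvd

/-- For `k ≠ 0` the momentum of `-k` is `2π - q` rather than `-q`; the difference is invisible at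
integer arguments. -/
theorem phase_neg (k : Fin N) (x : ℤ) : phase (-k) x = phase k (-x) := by
  have h : ((-k : Fin N) + k).val = 0 := by simp
  rw [Fin.val_add] at h
  obtain ⟨m, hm⟩ := Nat.dvd_of_mod_eq_zero h
  have hm' : ((-k : Fin N).val : ℂ) = N * m - k.val := by
    rw [eq_sub_iff_add_eq]; exact_mod_cast hm
  rw [phase, phase, Complex.exp_eq_exp_iff_exists_int]
  refine ⟨m * x, ?_⟩
  have := natCast_ne_zero' (N := N)
  simp only [momentum]
  push_cast
  rw [hm']
  field_simp
  ring

theorem sum_phase (x : ℤ) : ∑ k : Fin N, phase k x = if (N : ℤ) ∣ x then (N : ℂ) else 0 := by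
  split_ifs with h
  · simp [phase_of_dvd _ h]
  · simp only [phase_eq_pow]
    rw [Fin.sum_univ_eq_sum_range fun k => Complex.exp (2 * Real.pi * Complex.I * x / N) ^ k]
    have h1 : Complex.exp (2 * Real.pi * Complex.I * x / N) ≠ 1 := by
      intro h1
      rw [Complex.exp_eq_one_iff] at h1
      obtain ⟨m, hm⟩ := h1
      have := natCast_ne_zero' (N := N)
      rw [div_eq_iff this] at hm
      have h2 : (2 * Real.pi * Complex.I : ℂ) ≠ 0 := Complex.two_pi_I_ne_zero
      have : (x : ℂ) = N * m := by
        apply mul_left_cancel₀ h2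
        rw [hm]; ring
      exact h ⟨m, by exact_mod_cast this⟩
    rw [geom_sum_eq h1, ← Complex.exp_nat_mul]
    have : Complex.exp (N * (2 * Real.pi * Complex.I * x / N)) = 1 := by
      rw [Complex.exp_eq_one_iff]
      refine ⟨x, ?_⟩
      have := natCast_ne_zero' (N := N)
      field_simp
    rw [this]
    simp

theorem dvd_val_sub_iff (j l : Fin N) (d : ℕ) :
    (N : ℤ) ∣ (j.val + d : ℤ) - l.val ↔ l = j + Fin.ofNat N d := by
  rw [Fin.ext_iff, Fin.val_add, Fin.val_ofNat, Nat.add_mod_mod]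
  have h : (N : ℤ) ∣ (j.val + d : ℤ) - l.val ↔ l.val ≡ j.val + d [MOD N] := by
    rw [← Int.natCast_modEq_iff, Int.modEq_iff_dvd]
    push_cast
    rfl
  rw [h, Nat.ModEq, Nat.mod_eq_of_lt l.isLt]

theorem sum_phase_mul_phase (k l : Fin N) (c : ℤ) :
    ∑ j : Fin N, phase k (-(j.val + c)) * phase l (j.val + c) = if k = l then (N : ℂ) else 0 := by
  have h : ∀ j : Fin N, phase k (-(j.val + c)) * phase l (j.val + c) =
      phase k (-c) * phase l c * phase j ((l.val + (0 : ℕ) : ℤ) - k.val) := by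
    intro j
    rw [phase_add l, ← star_phase k, phase_add k, phase_sub, Nat.cast_zero, add_zero,
      ← star_phase j, phase_swap j l, phase_swap j k, star_mul', star_phase k c]
    ring
  simp only [h]
  rw [← Finset.mul_sum, sum_phase]
  simp only [dvd_val_sub_iff]
  have : (Fin.ofNat N 0 : Fin N) = 0 := rfl
  rw [this, add_zero]
  split_ifs with hkl
  · rw [hkl, ← phase_add]; simp [phase_zero]
  · simp

end

/-- Canonical anticommutation relations. -/
structure CAR (b : Fin N → Op N) : Prop where
  anti : ∀ k l, b k * b l + b l * b k = 0
  anti_star : ∀ k l, b k * (b l)ᴴ + (b l)ᴴ * b k = if k = l then 1 else 0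

namespace CAR

variable {b : Fin N → Op N} (hb : CAR b)

include hb

theorem star_anti (k l : Fin N) : (b k)ᴴ * (b l)ᴴ + (b l)ᴴ * (b k)ᴴ = 0 := by
  have := congrArg conjTranspose (hb.anti l k)
  simpa using this

theorem star_mul_swap (k l : Fin N) : (b k)ᴴ * (b l)ᴴ = -((b l)ᴴ * (b k)ᴴ) :=
  eq_neg_of_add_eq_zero_left (hb.star_anti k l)

theorem mul_star_swap {k l : Fin N} (h : k ≠ l) : b k * (b l)ᴴ = -((b l)ᴴ * b k) :=
  eq_neg_of_add_eq_zero_left (by rw [hb.anti_star, if_neg h])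

theorem mul_star_self (k : Fin N) : b k * (b k)ᴴ = 1 - (b k)ᴴ * b k :=
  eq_sub_of_add_eq (by rw [hb.anti_star, if_pos rfl])

theorem star_mul_star_self (k : Fin N) : (b k)ᴴ * (b k)ᴴ = 0 := by
  have h := hb.star_anti k k
  rw [← two_smul ℂ] at h
  exact (smul_eq_zero.mp h).resolve_left two_ne_zero

/-- The Bogoliubov transformation preserves the canonical anticommutation relations. -/
theorem bogoliubov [NeZero N] {θ : Fin N → ℝ} (hθ : ∀ k, Real.sin (θ k + θ (-k)) = 0) :
    CAR fun k => (Real.cos (θ k) : ℂ) • b k +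
      (Complex.I * (Real.sin (θ k) : ℂ)) • (b (-k))ᴴ where
  anti k l := by
    have h1 := hb.anti k l
    have h2 := hb.star_anti (-k) (-l)
    have h3 := hb.anti_star k (-l)
    have h4 := hb.anti_star l (-k)
    have h5 : (if k = -l then (1 : Op N) else 0) = if l = -k then 1 else 0 := by
      simp only [eq_neg_iff_add_eq_zero, add_comm]
    -- The mixed anticommutators contribute `sin (θ_k + θ_l)`, and only for `l = -k`, where it
    -- vanishes by hypothesis.
    have h6 : (((Real.sin (θ l) * Real.cos (θ k) + Real.cos (θ l) * Real.sin (θ k) : ℝ) : ℂ)) •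
        (if l = -k then (1 : Op N) else 0) = 0 := by
      split_ifs with h
      · rw [← Real.sin_add, h, add_comm, hθ]; simp
      · simp
    rw [h5] at h3
    simp only [add_mul, mul_add, smul_mul_assoc, mul_smul_comm]
    generalize (if l = -k then (1 : Op N) else 0) = δ at *
    push_cast at h6 ⊢
    linear_combination (norm := module) (Complex.cos (θ k) * Complex.cos (θ l)) • h1 +
      (Complex.I * Complex.I * Complex.sin (θ k) * Complex.sin (θ l)) • h2 +
      (Complex.I * Complex.cos (θ k) * Complex.sin (θ l)) • h3 +
      (Complex.I * Complex.cos (θ l) * Complex.sin (θ k)) • h4 + Complex.I • h6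
  anti_star k l := by
    have h1 := hb.anti k (-l)
    have h2 := hb.star_anti (-k) l
    have h3 := hb.anti_star k l
    have h4 := hb.anti_star (-l) (-k)
    have h5 : (if -l = -k then (1 : Op N) else 0) = if k = l then 1 else 0 := by
      simp only [neg_inj, eq_comm]
    have h6 : (Complex.cos (θ k) * Complex.cos (θ l) + Complex.sin (θ k) * Complex.sin (θ l)) •
        (if k = l then (1 : Op N) else 0) = if k = l then 1 else 0 := by
      split_ifs with h
      · rw [h, ← pow_two, ← pow_two, Complex.cos_sq_add_sin_sq, one_smul]
      · simp
    rw [h5] at h4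
    have hI : Complex.I * Complex.I = -1 := Complex.I_mul_I
    simp only [conjTranspose_add, conjTranspose_smul, conjTranspose_conjTranspose,
      Complex.star_def, map_mul, Complex.conj_I, Complex.conj_ofReal, add_mul, mul_add,
      smul_mul_assoc, mul_smul_comm]
    generalize (if k = l then (1 : Op N) else 0) = δ at *
    push_cast
    have h7 : ∀ M : Op N, (Complex.I * Complex.I * (Complex.sin (θ k) * Complex.sin (θ l))) • M =
      -((Complex.sin (θ k) * Complex.sin (θ l)) • M) := by
      intro M; rw [hI, mul_smul, neg_one_smul]
    have h8 := h7 ((b (-k))ᴴ * b (-l))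
    have h9 := h7 (b (-l) * (b (-k))ᴴ)
    linear_combination (norm := module) (Complex.cos (θ k) * Complex.cos (θ l)) • h3 -
      (Complex.I * Complex.cos (θ k) * Complex.sin (θ l)) • h1 +
      (Complex.I * Complex.cos (θ l) * Complex.sin (θ k)) • h2 +
      (Complex.sin (θ k) * Complex.sin (θ l)) • h4 + h6 - h8 - h9

end CAR

end

/-! ### The fermionic Hamiltonian in momentum space. -/

section

open Matrix

variable {N : ℕ}

/-- The matrix `(σ^x + i σ^y) / 2`. -/
def pauliPlus : Matrix (Fin 2) (Fin 2) ℂ := (1 / 2 : ℂ) • (pauliX + Complex.I • pauliY)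

theorem pauliPlus_eq : pauliPlus = !![0, 1; 0, 0] := by
  ext a b
  fin_cases a <;> fin_cases b <;> simp [pauliPlus, pauliX, pauliY]
  norm_num

theorem offDiagonal_pauliPlus : OffDiagonal pauliPlus := by
  simp [OffDiagonal, pauliPlus_eq]

theorem jordanWigner_eq_jw (j : Fin N) : jordanWigner j = jw pauliPlus j := jordanWigner_eq j

theorem jordanWigner_conjTranspose (j : Fin N) : (jordanWigner j)ᴴ = jw pauliPlusᴴ j := by
  rw [jordanWigner_eq_jw, jw_conjTranspose]

theorem car_jordanWigner : CAR (jordanWigner (N := N)) where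
  anti k l := by
    simp only [jordanWigner_eq_jw]
    by_cases h : k = l
    · have : pauliPlus * pauliPlus = (0 : ℂ) • 1 := by
        ext a b
        fin_cases a <;> fin_cases b <;> simp [pauliPlus_eq]
      rw [h, jw_mul_same, this, siteOp_smul]
      simp
    · rw [jw_anticomm h offDiagonal_pauliPlus offDiagonal_pauliPlus, neg_add_cancel]
  anti_star k l := by
    simp only [jordanWigner_eq_jw, jw_conjTranspose]
    split_ifs with h
    · have : pauliPlus * pauliPlusᴴ + pauliPlusᴴ * pauliPlus = 1 := by
        ext a b
        fin_cases a <;> fin_cases b <;> simp [pauliPlus_eq, Matrix.mul_apply, Fin.sum_univ_two, -cons_mul]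
      rw [h, jw_mul_same, jw_mul_same, ← siteOp_add, this, siteOp_one]
    · rw [jw_anticomm h offDiagonal_pauliPlus offDiagonal_pauliPlus.conjTranspose, neg_add_cancel]

theorem jw_pauliX_eq (j : Fin N) : jw pauliX j = jordanWigner j + (jordanWigner j)ᴴ := by
  rw [jordanWigner_eq_jw, jw_conjTranspose, ← jw_add]
  congr 1
  ext a b
  fin_cases a <;> fin_cases b <;> simp [pauliX, pauliPlus_eq]

theorem jw_pauliY_eq (j : Fin N) :
    Complex.I • jw pauliY j = jordanWigner j - (jordanWigner j)ᴴ := by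
  rw [jordanWigner_eq_jw, jw_conjTranspose, eq_sub_iff_add_eq, ← jw_smul, ← jw_add]
  congr 1
  ext a b
  fin_cases a <;> fin_cases b <;> simp [pauliY, pauliPlus_eq]

theorem sum_smul_anticomm {ι : Type*} [Fintype ι] (c d : ℂ) (f g : ι → ℂ) (x y : ι → Op N) :
    (c • ∑ i, f i • x i) * (d • ∑ j, g j • y j) + (d • ∑ j, g j • y j) * (c • ∑ i, f i • x i) =
      (c * d) • ∑ i, ∑ j, (f i * g j) • (x i * y j + y j * x i) := by
  simp only [smul_mul_assoc, mul_smul_comm, Finset.sum_mul, Finset.mul_sum, smul_add,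
    Finset.sum_add_distrib, smul_smul, Finset.smul_sum]
  congr 1
  · rw [Finset.sum_comm]
    exact Finset.sum_congr rfl fun i _ => Finset.sum_congr rfl fun j _ => by
      congr 1; ring
  · exact Finset.sum_congr rfl fun i _ => Finset.sum_congr rfl fun j _ => by
      congr 1; ring

theorem fourierMode_momentum (k : Fin N) :
    fourierMode N (momentum k) =
      (1 / (Real.sqrt N : ℂ)) • ∑ j : Fin N, phase k (-(j.val + 1)) • jordanWigner j := by
  unfold fourierMode phase
  congr 1
  refine Finset.sum_congr rfl fun j _ => ?_
  push_cast
  ring_nf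

theorem one_div_sqrt_mul_self : (1 / (Real.sqrt N : ℂ)) * (1 / (Real.sqrt N : ℂ)) = 1 / (N : ℂ) := by
  rw [div_mul_div_comm, one_mul, ← Complex.ofReal_mul, Real.mul_self_sqrt (Nat.cast_nonneg N),
    Complex.ofReal_natCast]

section

variable [NeZero N]

theorem fourierMode_neg_momentum (k : Fin N) :
    fourierMode N (-momentum k) = fourierMode N (momentum (-k)) := by
  rw [fourierMode_momentum]
  unfold fourierMode
  congr 1
  refine Finset.sum_congr rfl fun j _ => ?_
  rw [phase_neg, phase]
  push_cast
  ring_nf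

theorem fourierMode_momentum_star (k : Fin N) :
    (fourierMode N (momentum k))ᴴ =
      (1 / (Real.sqrt N : ℂ)) • ∑ j : Fin N, phase k (j.val + 1) • (jordanWigner j)ᴴ := by
  rw [fourierMode_momentum, conjTranspose_smul, conjTranspose_sum]
  congr 1
  · simp
  · refine Finset.sum_congr rfl fun j _ => ?_
    rw [conjTranspose_smul, star_phase, neg_neg]

theorem car_fourierMode : CAR fun k : Fin N => fourierMode N (momentum k) where
  anti k l := by
    simp only [fourierMode_momentum, sum_smul_anticomm, car_jordanWigner.anti]
    simp
  anti_star k l := by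
    rw [fourierMode_momentum_star, fourierMode_momentum, sum_smul_anticomm]
    simp only [car_jordanWigner.anti_star, smul_ite, smul_zero, Finset.sum_ite_eq,
      Finset.mem_univ, if_true]
    rw [← Finset.sum_smul, sum_phase_mul_phase, one_div_sqrt_mul_self, smul_smul]
    split_ifs
    · rw [one_div_mul_cancel natCast_ne_zero', one_smul]
    · simp

/-- The symbol of the fermionic Hamiltonian, `e^{iq} (1 + lam e^{-i(n+2)q})`. -/
def hSymbol (n : ℕ) (lam : ℝ) (k : Fin N) : ℂ := phase k 1 + lam * phase k (-(n + 1))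

/-- In the Majorana operators `c + c†` and `c - c†` the Hamiltonian is a translation-invariant
bilinear form. Its symbol is the Fourier transform of the coupling: `e^{iq}` from the Ising term at
distance `1`, and `λ e^{-i(n+1)q}` from the cluster term, whose two Majorana operators stand in the
opposite order. -/
theorem oddHamiltonian_eq_sum (n : ℕ) (lam : ℝ) :
    oddHamiltonian N n lam = -∑ k : Fin N, hSymbol n lam k •
      ((fourierMode N (momentum (-k)) - (fourierMode N (momentum k))ᴴ) *
        (fourierMode N (momentum k) + (fourierMode N (momentum (-k)))ᴴ)) := by
  have hA : ∀ k : Fin N, fourierMode N (momentum k) + (fourierMode N (momentum (-k)))ᴴ =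
      (1 / (Real.sqrt N : ℂ)) • ∑ j : Fin N, phase k (-(j.val + 1)) • jw pauliX j := by
    intro k
    rw [fourierMode_momentum, fourierMode_momentum_star, ← smul_add, ← Finset.sum_add_distrib]
    simp only [phase_neg, jw_pauliX_eq, smul_add]
  have hB : ∀ k : Fin N, fourierMode N (momentum (-k)) - (fourierMode N (momentum k))ᴴ =
      (1 / (Real.sqrt N : ℂ)) • ∑ j : Fin N, phase k (j.val + 1) • (Complex.I • jw pauliY j) := by
    intro k
    rw [fourierMode_momentum, fourierMode_momentum_star, ← smul_sub, ← Finset.sum_sub_distrib]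
    simp only [phase_neg, jw_pauliY_eq, smul_sub, neg_neg]
  -- The inverse Fourier transform of the symbol is the coupling between sites.
  have hd : ∀ j l : Fin N, (1 / (N : ℂ)) * ∑ k : Fin N,
      hSymbol n lam k * (phase k (j.val + 1) * phase k (-(l.val + 1))) =
      (if l = j + Fin.ofNat N 1 then 1 else 0) +
        lam * if j = l + Fin.ofNat N (n + 1) then 1 else 0 := by
    intro j l
    have h : ∀ k : Fin N, hSymbol n lam k * (phase k (j.val + 1) * phase k (-(l.val + 1))) =
        phase k ((j.val + (1 : ℕ) : ℤ) - l.val) +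
          lam * phase k (-((l.val + (n + 1 : ℕ) : ℤ) - j.val)) := by
      intro k
      have e1 : ((j.val + (1 : ℕ) : ℤ) - l.val) = 1 + ((j.val + 1) + -(l.val + 1)) := by
        push_cast; ring
      have e2 : (-((l.val + (n + 1 : ℕ) : ℤ) - j.val)) =
          -((n : ℤ) + 1) + ((j.val + 1) + -(l.val + 1)) := by
        push_cast; ring
      rw [e1, e2, phase_add k 1, phase_add k (-(n + 1)), phase_add k (j.val + 1), hSymbol]
      ring
    simp only [h]
    rw [Finset.sum_add_distrib, ← Finset.mul_sum, sum_phase, sum_phase, mul_add]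
    simp only [dvd_neg, dvd_val_sub_iff]
    have := natCast_ne_zero' (N := N)
    split_ifs <;> field_simp <;> simp
  have key : ∀ k : Fin N, hSymbol n lam k •
      ((fourierMode N (momentum (-k)) - (fourierMode N (momentum k))ᴴ) *
        (fourierMode N (momentum k) + (fourierMode N (momentum (-k)))ᴴ)) =
      ∑ j, ∑ l, ((1 / (N : ℂ)) * (hSymbol n lam k *
        (phase k (j.val + 1) * phase k (-(l.val + 1))))) •
          (Complex.I • (jw pauliY j * jw pauliX l)) := by
    intro k
    rw [hA, hB]
    simp only [smul_mul_assoc, mul_smul_comm, Finset.sum_mul, Finset.mul_sum, smul_smul,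
      Finset.smul_sum, ← one_div_sqrt_mul_self]
    refine (Finset.sum_comm).trans (Finset.sum_congr rfl fun i _ =>
      Finset.sum_congr rfl fun j _ => ?_)
    congr 1; ring
  -- The two kinds of Majorana operators anticommute even at equal sites, so the cluster term can be
  -- reordered like the Ising term.
  have hanti : ∀ i j : Fin N, jw pauliX i * jw pauliY j = -(jw pauliY j * jw pauliX i) := by
    intro i j
    by_cases h : i = j
    · rw [h, jw_mul_same, jw_mul_same]
      have : pauliX * pauliY = (-1 : ℂ) • (pauliY * pauliX) := by
        ext a b
        fin_cases a <;> fin_cases b <;> simp [pauliX, pauliY]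
      rw [this, siteOp_smul]
      simp
    · exact jw_anticomm h offDiagonal_pauliX offDiagonal_pauliY
  have hsum : ∑ k : Fin N, hSymbol n lam k •
      ((fourierMode N (momentum (-k)) - (fourierMode N (momentum k))ᴴ) *
        (fourierMode N (momentum k) + (fourierMode N (momentum (-k)))ᴴ)) =
      ∑ j, ∑ l : Fin N, ((if l = j + Fin.ofNat N 1 then (1 : ℂ) else 0) +
        lam * if j = l + Fin.ofNat N (n + 1) then 1 else 0) •
          (Complex.I • (jw pauliY j * jw pauliX l)) := by
    simp only [key]
    rw [Finset.sum_comm]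
    refine Finset.sum_congr rfl fun j _ => ?_
    rw [Finset.sum_comm]
    refine Finset.sum_congr rfl fun l _ => ?_
    rw [← Finset.sum_smul, ← Finset.mul_sum, hd]
  rw [hsum]
  simp only [add_smul, Finset.sum_add_distrib, ite_smul, mul_ite, mul_one, mul_zero, one_smul,
    zero_smul, Finset.sum_ite_eq', Finset.mem_univ, if_true, neg_add]
  unfold oddHamiltonian
  congr 1
  · simp only [neg_smul, Finset.sum_neg_distrib]
  · rw [Finset.sum_comm]
    simp only [Finset.sum_ite_eq', Finset.mem_univ, if_true, hanti, smul_neg,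
      Finset.sum_neg_distrib, Finset.smul_sum]

end

end

/-! ### The Bogoliubov angle and the diagonalized Hamiltonian. -/

section

open Matrix

variable {N : ℕ} [NeZero N]

theorem hSymbol_eq (n : ℕ) (lam : ℝ) (k : Fin N) :
    hSymbol n lam k = Complex.exp (Complex.I * momentum k) *
      (1 + lam * Complex.exp (-(Complex.I * ((n : ℂ) + 2) * momentum k))) := by
  rw [hSymbol, phase, phase, mul_add, mul_one, mul_left_comm, ← Complex.exp_add]
  push_cast
  ring_nf

theorem hSymbol_neg (n : ℕ) (lam : ℝ) (k : Fin N) :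
    hSymbol n lam (-k) = star (hSymbol n lam k) := by
  rw [hSymbol, hSymbol, star_add, star_mul', star_phase, star_phase, phase_neg, phase_neg,
    Complex.star_def, Complex.conj_ofReal]

theorem bogoliubovAngle_momentum (n : ℕ) (lam : ℝ) (k : Fin N) :
    bogoliubovAngle n lam (momentum k) = (hSymbol n lam k).arg / 2 := by
  rw [hSymbol_eq, bogoliubovAngle]

theorem norm_hSymbol (n : ℕ) (lam : ℝ) (k : Fin N) :
    ‖hSymbol n lam k‖ = ‖(1 : ℂ) + lam * Complex.exp (Complex.I * ((n : ℂ) + 2) * momentum k)‖ := by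
  rw [hSymbol_eq, norm_mul, mul_comm Complex.I, Complex.norm_exp_ofReal_mul_I, one_mul,
    ← Complex.norm_conj]
  congr 1
  rw [map_add, map_mul, ← Complex.exp_conj]
  have h2 : (starRingEnd ℂ) 2 = 2 := Complex.conj_ofNat 2
  simp [h2]

theorem momentum_eq_zero_iff (k : Fin N) : momentum k = 0 ↔ k = 0 := by
  have h : (N : ℝ) ≠ 0 := Nat.cast_ne_zero.mpr (NeZero.ne N)
  simp [momentum, h, Real.pi_ne_zero]

theorem hSymbol_zero (n : ℕ) (lam : ℝ) : hSymbol n lam (0 : Fin N) = ((1 + lam : ℝ) : ℂ) := by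
  have h0 : momentum (0 : Fin N) = 0 := (momentum_eq_zero_iff 0).mpr rfl
  simp only [hSymbol, phase, h0]
  simp

/-- The separate convention `ε_0 = 2(1 + λ)` agrees with the modulus because `1 + λ > 0`. -/
theorem modeEnergy_momentum (n : ℕ) {lam : ℝ} (h : -1 < lam) (k : Fin N) :
    modeEnergy n lam (momentum k) = 2 * ‖hSymbol n lam k‖ := by
  rw [modeEnergy]
  split_ifs with hk
  · rw [momentum_eq_zero_iff] at hk
    rw [hk, hSymbol_zero, Complex.norm_real, Real.norm_of_nonneg (by linarith)]
  · rw [norm_hSymbol]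

/-- The two terms of the symbol have moduli `1` and `|λ| < 1`. -/
theorem hSymbol_ne_zero (n : ℕ) {lam : ℝ} (h : lam ∈ Set.Ioo (-1 : ℝ) 1) (k : Fin N) :
    hSymbol n lam k ≠ 0 := by
  intro h0
  rw [hSymbol, add_eq_zero_iff_eq_neg] at h0
  have := congrArg norm h0
  have hp : ∀ x, ‖phase k x‖ = 1 := fun x => by
    rw [phase, mul_assoc, mul_comm, mul_comm _ (x : ℂ)]
    exact_mod_cast Complex.norm_exp_ofReal_mul_I (x * momentum k)
  rw [norm_neg, norm_mul, hp, hp, Complex.norm_real, mul_one, Real.norm_eq_abs] at this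
  exact absurd this (abs_lt.mpr h).ne'

theorem modeEnergy_momentum_pos (n : ℕ) {lam : ℝ} (h : lam ∈ Set.Ioo (-1 : ℝ) 1) (k : Fin N) :
    0 < modeEnergy n lam (momentum k) := by
  rw [modeEnergy_momentum n h.1]
  have := norm_pos_iff.mpr (hSymbol_ne_zero n h k)
  positivity

theorem modeEnergy_momentum_neg (n : ℕ) {lam : ℝ} (h : -1 < lam) (k : Fin N) :
    modeEnergy n lam (momentum (-k)) = modeEnergy n lam (momentum k) := by
  rw [modeEnergy_momentum n h, modeEnergy_momentum n h, hSymbol_neg, norm_star]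

theorem bogoliubovAngle_zero (n : ℕ) {lam : ℝ} (h : -1 < lam) :
    bogoliubovAngle n lam (momentum (0 : Fin N)) = 0 := by
  rw [bogoliubovAngle_momentum, hSymbol_zero, Complex.arg_ofReal_of_nonneg (by linarith), zero_div]

theorem cos_two_mul_bogoliubovAngle_neg (n : ℕ) (lam : ℝ) (k : Fin N) :
    Real.cos (2 * bogoliubovAngle n lam (momentum (-k))) =
      Real.cos (2 * bogoliubovAngle n lam (momentum k)) := by
  simp only [bogoliubovAngle_momentum, hSymbol_neg, mul_div_cancel₀ _ (two_ne_zero' ℝ),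
    Complex.star_def, Complex.arg_conj]
  split_ifs with h
  · rw [h]
  · rw [Real.cos_neg]

theorem sin_two_mul_bogoliubovAngle_neg (n : ℕ) (lam : ℝ) (k : Fin N) :
    Real.sin (2 * bogoliubovAngle n lam (momentum (-k))) =
      -Real.sin (2 * bogoliubovAngle n lam (momentum k)) := by
  simp only [bogoliubovAngle_momentum, hSymbol_neg, mul_div_cancel₀ _ (two_ne_zero' ℝ),
    Complex.star_def, Complex.arg_conj]
  split_ifs with h
  · rw [h]; simp
  · rw [Real.sin_neg]

/-- The angle is odd in the momentum unless the symbol is a negative real number; then both angles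
equal `π/2`. The vanishing sine covers both cases, and is all that the fermionic algebra needs. -/
theorem sin_bogoliubovAngle_add_neg (n : ℕ) (lam : ℝ) (k : Fin N) :
    Real.sin (bogoliubovAngle n lam (momentum k) + bogoliubovAngle n lam (momentum (-k))) = 0 := by
  simp only [bogoliubovAngle_momentum, hSymbol_neg, Complex.star_def, Complex.arg_conj]
  split_ifs with h
  · rw [h, add_halves, Real.sin_pi]
  · rw [neg_div, add_neg_cancel, Real.sin_zero]

theorem hSymbol_eq_energy_mul (n : ℕ) {lam : ℝ} (h : -1 < lam) (k : Fin N) :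
    hSymbol n lam k = (modeEnergy n lam (momentum k) : ℂ) / 2 *
      (Real.cos (2 * bogoliubovAngle n lam (momentum k)) +
        Complex.I * Real.sin (2 * bogoliubovAngle n lam (momentum k))) := by
  rw [bogoliubovAngle_momentum, mul_div_cancel₀ _ (two_ne_zero' ℝ), modeEnergy_momentum n h]
  conv_lhs => rw [← Complex.norm_mul_exp_arg_mul_I (hSymbol n lam k), Complex.exp_mul_I]
  push_cast
  ring

theorem momentum_ne_pi (hN : Odd N) (k : Fin N) : momentum k ≠ Real.pi := by
  intro h
  have hN0 : (N : ℝ) ≠ 0 := Nat.cast_ne_zero.mpr (NeZero.ne N)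
  rw [momentum, div_eq_iff hN0, mul_comm 2, mul_assoc] at h
  have h2 := mul_left_cancel₀ Real.pi_ne_zero h
  have h3 : 2 * k.val = N := by exact_mod_cast h2
  exact (Nat.not_even_iff_odd.mpr hN) ⟨k.val, by omega⟩

/-- The exceptional clause of the definition is harmless: for odd `N` the momentum `π` does not
occur, and at `0` the angle vanishes. -/
theorem bogoliubovMode_momentum (hN : Odd N) (n : ℕ) {lam : ℝ} (h : -1 < lam) (k : Fin N) :
    bogoliubovMode N n lam (momentum k) =
      (Real.cos (bogoliubovAngle n lam (momentum k)) : ℂ) • fourierMode N (momentum k) +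
        (Complex.I * (Real.sin (bogoliubovAngle n lam (momentum k)) : ℂ)) •
          (fourierMode N (momentum (-k)))ᴴ := by
  rw [bogoliubovMode]
  split_ifs with hk
  · rcases hk with hk | hk
    · rw [momentum_eq_zero_iff] at hk
      rw [hk, bogoliubovAngle_zero n h]
      simp
    · exact absurd hk (momentum_ne_pi hN k)
  · rw [fourierMode_neg_momentum]

theorem car_bogoliubovMode (hN : Odd N) (n : ℕ) {lam : ℝ} (h : -1 < lam) :
    CAR fun k : Fin N => bogoliubovMode N n lam (momentum k) := by
  simp only [bogoliubovMode_momentum hN n h]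
  exact car_fourierMode.bogoliubov (sin_bogoliubovAngle_add_neg n lam)

/-- The two forms of the Hamiltonian are compared pair by pair, adding the summands at `k` and `-k`.
-/
theorem sum_eq_sum_of_symmetrized {f g : Fin N → Op N}
    (h : ∀ k, f k + f (-k) = g k + g (-k)) : ∑ k, f k = ∑ k, g k := by
  have hs : ∀ f : Fin N → Op N, (2 : ℂ) • ∑ k, f k = ∑ k, (f k + f (-k)) := by
    intro f
    rw [Finset.sum_add_distrib, two_smul]
    congr 1
    exact (Equiv.sum_comp (Equiv.neg (Fin N)) f).symm
  have := hs f
  simp only [h] at this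
  rw [← hs g] at this
  exact smul_right_injective _ (two_ne_zero' ℂ) this

/-- The fermionic Hamiltonian in terms of the Bogoliubov fermions. -/
theorem oddHamiltonian_eq (hN : Odd N) (n : ℕ) {lam : ℝ} (h : -1 < lam) :
    oddHamiltonian N n lam = ∑ k : Fin N, ((modeEnergy n lam (momentum k) : ℂ) •
      ((bogoliubovMode N n lam (momentum k))ᴴ * bogoliubovMode N n lam (momentum k)) -
        ((modeEnergy n lam (momentum k) : ℂ) / 2) • 1) := by
  rw [oddHamiltonian_eq_sum, ← Finset.sum_neg_distrib]
  refine sum_eq_sum_of_symmetrized fun k => ?_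
  have hb := car_fourierMode (N := N)
  have r1 := hb.anti k (-k)
  have r2 := hb.star_anti k (-k)
  have r3 := hb.anti_star k k
  have r4 := hb.anti_star (-k) (-k)
  have hcos := cos_two_mul_bogoliubovAngle_neg n lam k
  have hsin := sin_two_mul_bogoliubovAngle_neg n lam k
  have hk := hSymbol_eq_energy_mul n h k
  have hk' := hSymbol_eq_energy_mul n h (-k)
  rw [modeEnergy_momentum_neg n h, hcos, hsin] at hk'
  rw [hk, hk', bogoliubovMode_momentum hN n h, bogoliubovMode_momentum hN n h,
    modeEnergy_momentum_neg n h]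
  rw [if_pos rfl] at r3 r4
  simp only [neg_neg, conjTranspose_add, conjTranspose_smul, conjTranspose_conjTranspose,
      Complex.star_def, map_mul, Complex.conj_I, Complex.conj_ofReal]
  rw [Real.cos_two_mul, Real.cos_two_mul] at hcos
  rw [Real.sin_two_mul, Real.sin_two_mul] at hsin
  rw [Real.cos_two_mul, Real.sin_two_mul]
  have q := Real.sin_sq_add_cos_sq (bogoliubovAngle n lam (momentum k))
  have q' := Real.sin_sq_add_cos_sq (bogoliubovAngle n lam (momentum (-k)))
  generalize fourierMode N (momentum k) = p at *
  generalize fourierMode N (momentum (-k)) = m at *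
  generalize pᴴ = P at *
  generalize mᴴ = M at *
  generalize Real.cos (bogoliubovAngle n lam (momentum k)) = c at *
  generalize Real.sin (bogoliubovAngle n lam (momentum k)) = s at *
  generalize Real.cos (bogoliubovAngle n lam (momentum (-k))) = c' at *
  generalize Real.sin (bogoliubovAngle n lam (momentum (-k))) = s' at *
  generalize modeEnergy n lam (momentum k) = ε at *
  -- Because the angle need not be odd, the cosine and sine at `-k` enter only through their squares
  -- and their product, which the doubled angle determines.
  have e1 : (c' : ℂ) ^ 2 = (c : ℂ) ^ 2 := by norm_cast; linarith
  have e2 : (s' : ℂ) ^ 2 = 1 - (c : ℂ) ^ 2 := by norm_cast; linarith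
  have e3 : (s' : ℂ) * c' = -(s * c) := by norm_cast; linarith
  have e4 : (s : ℂ) ^ 2 = 1 - (c : ℂ) ^ 2 := by norm_cast; linarith
  have eI : Complex.I ^ 2 = -1 := Complex.I_sq
  have eIs : Complex.I ^ 2 * (s : ℂ) ^ 2 = -(1 - (c : ℂ) ^ 2) := by rw [eI, e4]; ring
  have eIs' : Complex.I ^ 2 * (s' : ℂ) ^ 2 = -(1 - (c : ℂ) ^ 2) := by rw [eI, e2]; ring
  simp only [add_mul, mul_add, sub_mul, smul_mul_assoc, mul_smul_comm]
  push_cast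
  -- Reordering reduces everything to the identity and four products of two fermions, whose
  -- coefficients are then compared.
  rw [eq_neg_of_add_eq_zero_right r1, eq_neg_of_add_eq_zero_right r2, eq_sub_of_add_eq r3,
    eq_sub_of_add_eq r4]
  generalize p * m = A
  generalize P * M = B
  generalize P * p = D
  generalize M * m = E
  linear_combination (norm := module) ((ε : ℂ) * Complex.I * e3) • (A + B) - ((ε : ℂ) * eIs') • D -
    ((ε : ℂ) * e1 + (ε : ℂ) * eIs) • E + ((ε : ℂ) * (eIs + eIs')) • (1 : Op N)

end

/-! ### Pair factors and the inductive construction of the Bogoliubov vacuum. -/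

section

open Matrix

section PairFactor

variable {N : ℕ} [NeZero N] {b : Fin N → Op N} {θ : Fin N → ℝ}

/-- The Bogoliubov transform of a family of fermions. -/
def bogoliubovTransform (b : Fin N → Op N) (θ : Fin N → ℝ) (k : Fin N) : Op N :=
  (Real.cos (θ k) : ℂ) • b k + (Complex.I * (Real.sin (θ k) : ℂ)) • (b (-k))ᴴ

/-- The factor `cos θ_k - i sin θ_k b_k† b_{-k}†`. -/
def pairFactor (b : Fin N → Op N) (θ : Fin N → ℝ) (k : Fin N) : Op N :=
  (Real.cos (θ k) : ℂ) • (1 : Op N) -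
    (Complex.I * (Real.sin (θ k) : ℂ)) • ((b k)ᴴ * (b (-k))ᴴ)

theorem bogoliubovTransform_star (k : Fin N) : (bogoliubovTransform b θ k)ᴴ =
    (Real.cos (θ k) : ℂ) • (b k)ᴴ - (Complex.I * (Real.sin (θ k) : ℂ)) • b (-k) := by
  rw [bogoliubovTransform, conjTranspose_add, conjTranspose_smul, conjTranspose_smul,
    conjTranspose_conjTranspose, sub_eq_add_neg, ← neg_smul, Complex.star_def,
    map_mul, Complex.conj_I, Complex.conj_ofReal, Complex.conj_ofReal, neg_mul]

theorem commute_pairFactor {M : Op N} {k : Fin N} (h : Commute M ((b k)ᴴ * (b (-k))ᴴ)) :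
    Commute M (pairFactor b θ k) :=
  ((Commute.one_right M).smul_right _).sub_right (h.smul_right _)

theorem pairFactor_mulVec (b : Fin N → Op N) (k : Fin N) (w : State N) : pairFactor b θ k *ᵥ w =
    (Real.cos (θ k) : ℂ) • w -
      (Complex.I * (Real.sin (θ k) : ℂ)) • ((b k)ᴴ *ᵥ ((b (-k))ᴴ *ᵥ w)) := by
  rw [pairFactor, sub_mulVec, smul_mulVec, smul_mulVec, one_mulVec, mulVec_mulVec]

variable (hb : CAR b)

include hb

theorem CAR.commute_pair {p k : Fin N} (h : p ≠ k) (h' : p ≠ -k) :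
    Commute (b p) ((b k)ᴴ * (b (-k))ᴴ) := by
  rw [Commute, SemiconjBy, ← mul_assoc, hb.mul_star_swap h, neg_mul, mul_assoc,
    hb.mul_star_swap h', mul_neg, neg_neg, mul_assoc]

theorem CAR.star_commute_pair (p k : Fin N) : Commute (b p)ᴴ ((b k)ᴴ * (b (-k))ᴴ) := by
  rw [Commute, SemiconjBy, ← mul_assoc, hb.star_mul_swap, neg_mul, mul_assoc,
    hb.star_mul_swap p (-k), mul_neg, neg_neg, mul_assoc]

theorem CAR.bogoliubovTransform_commute_pairFactor {p k : Fin N} (h : p ≠ k) (h' : p ≠ -k) :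
    Commute (bogoliubovTransform b θ p) (pairFactor b θ k) :=
  ((commute_pairFactor (hb.commute_pair h h')).smul_left _).add_left
    ((commute_pairFactor (hb.star_commute_pair _ _)).smul_left _)

theorem CAR.bogoliubovTransform_star_commute_pairFactor {p k : Fin N} (h : p ≠ k) (h' : p ≠ -k) :
    Commute (bogoliubovTransform b θ p)ᴴ (pairFactor b θ k) := by
  rw [bogoliubovTransform_star]
  exact ((commute_pairFactor (hb.star_commute_pair _ _)).smul_left _).sub_left
    ((commute_pairFactor (hb.commute_pair (fun e => h' (by rw [← e, neg_neg]))
      (fun e => h (neg_injective e)))).smul_left _)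

section Annihilated

variable {k : Fin N} (hk : k ≠ -k) {w : State N} (h1 : b k *ᵥ w = 0) (h2 : b (-k) *ᵥ w = 0)

include hk

include h1 in
theorem CAR.mulVec_pair : b k *ᵥ ((b k)ᴴ *ᵥ ((b (-k))ᴴ *ᵥ w)) = (b (-k))ᴴ *ᵥ w := by
  rw [mulVec_mulVec, hb.mul_star_self, sub_mulVec, one_mulVec, ← mulVec_mulVec,
    mulVec_mulVec _ (b k), hb.mul_star_swap hk, neg_mulVec, ← mulVec_mulVec, h1]
  simp

include h2 in
theorem CAR.neg_mulVec_pair : b (-k) *ᵥ ((b k)ᴴ *ᵥ ((b (-k))ᴴ *ᵥ w)) = -((b k)ᴴ *ᵥ w) := by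
  rw [mulVec_mulVec, hb.mul_star_swap hk.symm, neg_mulVec, ← mulVec_mulVec,
    mulVec_mulVec _ (b (-k)), hb.mul_star_self, sub_mulVec, one_mulVec, ← mulVec_mulVec, h2]
  simp

omit hk in
theorem CAR.star_mulVec_pair : (b k)ᴴ *ᵥ ((b k)ᴴ *ᵥ ((b (-k))ᴴ *ᵥ w)) = 0 := by
  rw [mulVec_mulVec, hb.star_mul_star_self, zero_mulVec]

omit hk in
theorem CAR.star_neg_mulVec_pair : (b (-k))ᴴ *ᵥ ((b k)ᴴ *ᵥ ((b (-k))ᴴ *ᵥ w)) = 0 := by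
  rw [mulVec_mulVec, hb.star_mul_swap, neg_mulVec, ← mulVec_mulVec, mulVec_mulVec _ (b (-k))ᴴ,
    hb.star_mul_star_self, zero_mulVec, mulVec_zero, neg_zero]

include h1 h2

theorem CAR.bogoliubovTransform_mulVec_pairFactor :
    bogoliubovTransform b θ k *ᵥ (pairFactor b θ k *ᵥ w) = 0 := by
  rw [pairFactor_mulVec, bogoliubovTransform]
  simp only [add_mulVec, smul_mulVec, mulVec_sub, mulVec_smul, h1, hb.mulVec_pair hk h1,
    hb.star_neg_mulVec_pair]
  module

/-- What remains is `i sin (θ_k + θ_{-k}) b_k† w`. For the mode `k` itself the two contributions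
cancel without any condition on the angles. -/
theorem CAR.bogoliubovTransform_neg_mulVec_pairFactor (hθ : Real.sin (θ k + θ (-k)) = 0) :
    bogoliubovTransform b θ (-k) *ᵥ (pairFactor b θ k *ᵥ w) = 0 := by
  rw [pairFactor_mulVec, bogoliubovTransform]
  simp only [neg_neg, add_mulVec, smul_mulVec, mulVec_sub, mulVec_smul, h2,
    hb.neg_mulVec_pair hk h2, hb.star_mulVec_pair]
  have h := congrArg (fun x : ℝ => (x : ℂ)) hθ
  simp only [Real.sin_add] at h
  push_cast at h ⊢
  linear_combination (norm := module) (Complex.I * h) • ((b k)ᴴ *ᵥ w)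

theorem CAR.bogoliubovTransform_star_mulVec_pairFactor :
    (bogoliubovTransform b θ k)ᴴ *ᵥ (pairFactor b θ k *ᵥ w) = (b k)ᴴ *ᵥ w := by
  rw [pairFactor_mulVec, bogoliubovTransform_star]
  simp only [sub_mulVec, smul_mulVec, mulVec_sub, mulVec_smul, h2,
    hb.neg_mulVec_pair hk h2, hb.star_mulVec_pair]
  have h := Complex.sin_sq_add_cos_sq (θ k)
  have hI := Complex.I_sq
  push_cast
  linear_combination (norm := module) (h - Complex.sin (θ k) ^ 2 * hI) • ((b k)ᴴ *ᵥ w)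

/-- The scalar does not matter later: the result only has to stay in the same eigenspace of the
translation. -/
theorem CAR.bogoliubovTransform_neg_star_mulVec_pairFactor :
    (bogoliubovTransform b θ (-k))ᴴ *ᵥ (pairFactor b θ k *ᵥ w) =
      (Real.cos (θ k + θ (-k)) : ℂ) • ((b (-k))ᴴ *ᵥ w) := by
  rw [pairFactor_mulVec, bogoliubovTransform_star, Real.cos_add]
  simp only [neg_neg, sub_mulVec, smul_mulVec, mulVec_sub, mulVec_smul, h1,
    hb.mulVec_pair hk h1, hb.star_neg_mulVec_pair]
  have hI := Complex.I_sq
  push_cast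
  linear_combination (norm := module)
    (Complex.sin (θ k) * Complex.sin (θ (-k)) * hI) • ((b (-k))ᴴ *ᵥ w)

/-- Applying `b_{-k} b_k` isolates the sine term. If that vanishes, the vector is `cos θ_k w`, and
sine and cosine are not both zero. -/
theorem CAR.pairFactor_mulVec_ne_zero (hw : w ≠ 0) : pairFactor b θ k *ᵥ w ≠ 0 := by
  intro h
  have h' := congrArg (fun ψ => b (-k) *ᵥ (b k *ᵥ ψ)) h
  simp only [pairFactor_mulVec, mulVec_sub, mulVec_smul, h1, hb.mulVec_pair hk h1] at h'
  have h3 : b (-k) *ᵥ ((b (-k))ᴴ *ᵥ w) = w := by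
    rw [mulVec_mulVec, hb.mul_star_self, sub_mulVec, one_mulVec, ← mulVec_mulVec, h2]
    simp
  simp only [h3, mulVec_zero, smul_zero, zero_sub, neg_eq_zero, smul_eq_zero, hw, or_false,
    mul_eq_zero, Complex.I_ne_zero, false_or, Complex.ofReal_eq_zero] at h'
  rw [pairFactor_mulVec, h'] at h
  simp only [Complex.ofReal_zero, mul_zero, zero_smul, sub_zero, smul_eq_zero, hw, or_false,
    Complex.ofReal_eq_zero] at h
  have := Real.sin_sq_add_cos_sq (θ k)
  rw [h, h'] at this
  norm_num at this

end Annihilated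

/-- The properties of the Bogoliubov vacuum, and of the states on the way to it, where only the
pairs of modes in the list `L` are transformed. `T` is a translation, `Z` the parity. -/
structure IsPartialVacuum (b : Fin N → Op N) (θ : Fin N → ℝ) (T Z : Op N) (L : List (Fin N))
    (w : State N) : Prop where
  ne_zero : w ≠ 0
  parity : Z *ᵥ w = w
  bare : ∀ p, p ∉ L → -p ∉ L → b p *ᵥ w = 0
  bare_translation : ∀ p, p ∉ L → -p ∉ L → T *ᵥ ((b p)ᴴ *ᵥ w) = phase p 1 • ((b p)ᴴ *ᵥ w)
  dressed : ∀ p, p ∈ L ∨ -p ∈ L → bogoliubovTransform b θ p *ᵥ w = 0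
  dressed_translation : ∀ p, p ∈ L ∨ -p ∈ L → T *ᵥ ((bogoliubovTransform b θ p)ᴴ *ᵥ w) =
    phase p 1 • ((bogoliubovTransform b θ p)ᴴ *ᵥ w)

/-- The new pair factor commutes with all modes other than `±k`, so their properties persist; for
`±k` the explicit two-mode formulas apply. The translation commutes with a pair only on odd vectors,
which is why the parity of `w` is carried along. -/
theorem CAR.isPartialVacuum_cons (hθ : ∀ k, Real.sin (θ k + θ (-k)) = 0) {T Z : Op N}
    (hZ : ∀ k, Z * b k = -(b k * Z)) (hZ' : ∀ k, Z * (b k)ᴴ = -((b k)ᴴ * Z))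
    (hT : ∀ k ψ, Z *ᵥ ψ = -ψ →
      T *ᵥ (((b k)ᴴ * (b (-k))ᴴ) *ᵥ ψ) = ((b k)ᴴ * (b (-k))ᴴ) *ᵥ (T *ᵥ ψ))
    {L : List (Fin N)} {w : State N} (hw : IsPartialVacuum b θ T Z L w) {k : Fin N} (hk : k ≠ -k)
    (hkL : k ∉ L) (hkL' : -k ∉ L) :
    IsPartialVacuum b θ T Z (k :: L) (pairFactor b θ k *ᵥ w) := by
  have h1 := hw.bare k hkL hkL'
  have h2 := hw.bare (-k) hkL' (by rwa [neg_neg])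
  have hTF : ∀ ψ, Z *ᵥ ψ = -ψ →
      T *ᵥ (pairFactor b θ k *ᵥ ψ) = pairFactor b θ k *ᵥ (T *ᵥ ψ) := by
    intro ψ hψ
    have := hT k ψ hψ
    simp only [← mulVec_mulVec] at this
    rw [pairFactor_mulVec, pairFactor_mulVec, mulVec_sub, mulVec_smul, mulVec_smul, this]
  have hodd : ∀ p, Z *ᵥ ((b p)ᴴ *ᵥ w) = -((b p)ᴴ *ᵥ w) := by
    intro p
    rw [mulVec_mulVec, hZ', neg_mulVec, ← mulVec_mulVec, hw.parity]
  have hodd0 : ∀ p, Z *ᵥ (b p *ᵥ w) = -(b p *ᵥ w) := by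
    intro p
    rw [mulVec_mulVec, hZ, neg_mulVec, ← mulVec_mulVec, hw.parity]
  have hodd' : ∀ p, Z *ᵥ ((bogoliubovTransform b θ p)ᴴ *ᵥ w) =
      -((bogoliubovTransform b θ p)ᴴ *ᵥ w) := by
    intro p
    rw [bogoliubovTransform_star]
    simp only [sub_mulVec, smul_mulVec, mulVec_sub, mulVec_smul, hodd, hodd0]
    module
  refine ⟨hb.pairFactor_mulVec_ne_zero hk h1 h2 hw.ne_zero, ?_, ?_, ?_, ?_, ?_⟩
  · rw [pairFactor_mulVec, mulVec_sub, mulVec_smul, mulVec_smul, hw.parity, mulVec_mulVec _ Z, hZ',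
      neg_mulVec, ← mulVec_mulVec, hodd, mulVec_neg, neg_neg]
  · intro p hp hp'
    rw [List.mem_cons, not_or] at hp hp'
    rw [mulVec_mulVec, (commute_pairFactor (hb.commute_pair hp.1
      (fun e => hp'.1 (by rw [e, neg_neg])))).eq, ← mulVec_mulVec, hw.bare p hp.2 hp'.2,
      mulVec_zero]
  · intro p hp hp'
    rw [List.mem_cons, not_or] at hp hp'
    rw [mulVec_mulVec _ (b p)ᴴ, (commute_pairFactor (hb.star_commute_pair _ _)).eq, ← mulVec_mulVec,
      hTF _ (hodd p), hw.bare_translation p hp.2 hp'.2, mulVec_smul]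
  · intro p hp
    by_cases e1 : p = k
    · rw [e1, hb.bogoliubovTransform_mulVec_pairFactor hk h1 h2]
    by_cases e2 : p = -k
    · rw [e2, hb.bogoliubovTransform_neg_mulVec_pairFactor hk h1 h2 (hθ k)]
    have hp' : p ∈ L ∨ -p ∈ L := by
      simpa [e1, neg_eq_iff_eq_neg, e2] using hp
    rw [mulVec_mulVec, (hb.bogoliubovTransform_commute_pairFactor e1 e2).eq, ← mulVec_mulVec,
      hw.dressed p hp', mulVec_zero]
  · intro p hp
    by_cases e1 : p = k
    · rw [e1, hb.bogoliubovTransform_star_mulVec_pairFactor hk h1 h2,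
        hw.bare_translation k hkL hkL']
    by_cases e2 : p = -k
    · rw [e2, hb.bogoliubovTransform_neg_star_mulVec_pairFactor hk h1 h2, mulVec_smul,
        hw.bare_translation (-k) hkL' (by rwa [neg_neg]), smul_comm]
    have hp' : p ∈ L ∨ -p ∈ L := by
      simpa [e1, neg_eq_iff_eq_neg, e2] using hp
    rw [mulVec_mulVec _ _ᴴ, (hb.bogoliubovTransform_star_commute_pairFactor e1 e2).eq,
      ← mulVec_mulVec, hTF _ (hodd' p), hw.dressed_translation p hp', mulVec_smul]

theorem CAR.isPartialVacuum_prod (hθ : ∀ k, Real.sin (θ k + θ (-k)) = 0) {T Z : Op N}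
    (hZ : ∀ k, Z * b k = -(b k * Z)) (hZ' : ∀ k, Z * (b k)ᴴ = -((b k)ᴴ * Z))
    (hT : ∀ k ψ, Z *ᵥ ψ = -ψ →
      T *ᵥ (((b k)ᴴ * (b (-k))ᴴ) *ᵥ ψ) = ((b k)ᴴ * (b (-k))ᴴ) *ᵥ (T *ᵥ ψ))
    {w : State N} (hw : IsPartialVacuum b θ T Z [] w) {L : List (Fin N)} (hL : L.Nodup)
    (hL' : ∀ k ∈ L, -k ∉ L) :
    IsPartialVacuum b θ T Z L ((L.map (pairFactor b θ)).prod *ᵥ w) := by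
  induction L with
  | nil => simpa using hw
  | cons k L ih =>
    rw [List.nodup_cons] at hL
    have h := hL' k List.mem_cons_self
    rw [List.mem_cons, not_or] at h
    rw [List.map_cons, List.prod_cons, ← mulVec_mulVec]
    exact hb.isPartialVacuum_cons hθ hZ hZ' hT
      (ih hL.2 fun l hl hl' => hL' l (List.mem_cons_of_mem _ hl) (List.mem_cons_of_mem _ hl'))
      (Ne.symm h.1) hL.1 h.2

end PairFactor

end

/-! ### The vacuum of the chain: parity, annihilation and momentum of one-particle states. -/

section

open Matrix

variable {N : ℕ}

theorem zString_mulVec_allUp (S : Finset (Fin N)) : zString S *ᵥ allUp N = allUp N := by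
  funext s
  rw [zString_mulVec, allUp, Pi.single_apply]
  split_ifs with h
  · simp [h, zsign]
  · simp

theorem parityZ_mulVec_allUp : parityZ N *ᵥ allUp N = allUp N := zString_mulVec_allUp _

theorem jw_mulVec_allUp (P : Matrix (Fin 2) (Fin 2) ℂ) (j : Fin N) :
    jw P j *ᵥ allUp N = siteOp P j *ᵥ allUp N := by
  rw [jw, ← siteOp_mul_zString_of_notMem (by simp), ← mulVec_mulVec, zString_mulVec_allUp]

theorem jordanWigner_mulVec_allUp (j : Fin N) : jordanWigner j *ᵥ allUp N = 0 := by
  rw [jordanWigner_eq_jw, jw_mulVec_allUp]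
  funext s
  rw [siteOp_mulVec, Fin.sum_univ_two]
  have h0 : pauliPlus (s j) 0 = 0 := by
    generalize s j = a
    fin_cases a <;> simp [pauliPlus_eq]
  have h1 : allUp N (Function.update s j 1) = 0 := by
    rw [allUp, Pi.single_apply, if_neg]
    intro h
    simpa using congrFun h j
  rw [h0, h1]
  simp

theorem fourierMode_mulVec_allUp (q : ℝ) : fourierMode N q *ᵥ allUp N = 0 := by
  simp [fourierMode, smul_mulVec, sum_mulVec, jordanWigner_mulVec_allUp]

theorem parityZ_mul_fourierMode (q : ℝ) :
    parityZ N * fourierMode N q = -(fourierMode N q * parityZ N) := by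
  have h : ∀ j : Fin N, parityZ N * jordanWigner j = -(jordanWigner j * parityZ N) := fun j => by
    rw [jordanWigner_eq_jw, jw_mul_parityZ offDiagonal_pauliPlus, neg_neg]
  simp only [fourierMode, mul_smul_comm, smul_mul_assoc, Finset.mul_sum, Finset.sum_mul, h,
    smul_neg, Finset.sum_neg_distrib]

theorem parityZ_conjTranspose : (parityZ N)ᴴ = parityZ N := zString_conjTranspose _

theorem parityZ_mul_star_of_anticomm {M : Op N} (h : parityZ N * M = -(M * parityZ N)) :
    parityZ N * Mᴴ = -(Mᴴ * parityZ N) := by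
  have := congrArg conjTranspose h
  rw [conjTranspose_neg, conjTranspose_mul, conjTranspose_mul, parityZ_conjTranspose] at this
  rw [this, neg_neg]

section

variable [NeZero N]

theorem translation_mulVec_allUp : translation N *ᵥ allUp N = allUp N := by
  funext s
  rw [translation_mulVec, allUp, Pi.single_apply, Pi.single_apply]
  refine if_congr ⟨fun h => funext fun j => ?_, fun h => by rw [h]⟩ rfl rfl
  simpa using congrFun h (j + Fin.ofNat N 1)

/-- Shifting the summation index by one site extracts `e^{iq}`; there is no seam because `e^{iqN} =
1`. -/
theorem fourierMode_momentum_star_shift (k : Fin N) :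
    (fourierMode N (momentum k))ᴴ = phase k 1 • (1 / (Real.sqrt N : ℂ)) •
      ∑ j : Fin N, phase k (j.val + 1) • (jordanWigner (j + Fin.ofNat N 1))ᴴ := by
  have h : ∑ j : Fin N, phase k (j.val + 1) • (jordanWigner j)ᴴ =
      phase k 1 • ∑ j : Fin N, phase k (j.val + 1) • (jordanWigner (j + Fin.ofNat N 1))ᴴ := by
    rw [Finset.smul_sum]
    refine (Equiv.sum_comp (Equiv.addRight (Fin.ofNat N 1)) _).symm.trans
      (Finset.sum_congr rfl fun j _ => ?_)
    rw [Equiv.coe_addRight, phase_add, phase_val_add, smul_smul, mul_comm]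
    push_cast
    rfl
  rw [fourierMode_momentum_star, h, smul_comm]

/-- Strings act trivially on the all-up state, so a single fermion on it is a plain spin flip and is
translated without boundary terms. -/
theorem translation_mulVec_fourierMode_allUp (k : Fin N) :
    translation N *ᵥ ((fourierMode N (momentum k))ᴴ *ᵥ allUp N) =
      phase k 1 • ((fourierMode N (momentum k))ᴴ *ᵥ allUp N) := by
  conv_lhs => rw [fourierMode_momentum_star_shift]
  rw [fourierMode_momentum_star, smul_mulVec, mulVec_smul]
  congr 1
  simp only [smul_mulVec, mulVec_smul, sum_mulVec, mulVec_sum]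
  congr 1
  refine Finset.sum_congr rfl fun j _ => ?_
  rw [jordanWigner_conjTranspose, jordanWigner_conjTranspose, jw_mulVec_allUp, jw_mulVec_allUp,
    mulVec_mulVec, ← siteOp_mul_translation, ← mulVec_mulVec, translation_mulVec_allUp]

/-- The phases `e^{iq}` and `e^{-iq}` of the two shifted modes cancel. -/
theorem translation_mulVec_pair (k : Fin N) (ψ : State N) (hψ : parityZ N *ᵥ ψ = -ψ) :
    translation N *ᵥ
        (((fourierMode N (momentum k))ᴴ * (fourierMode N (momentum (-k)))ᴴ) *ᵥ ψ) =
      ((fourierMode N (momentum k))ᴴ * (fourierMode N (momentum (-k)))ᴴ) *ᵥ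
        (translation N *ᵥ ψ) := by
  have h1 : phase k 1 * phase (-k) 1 = 1 := by
    rw [phase_neg, ← phase_add, add_neg_cancel, phase_zero]
  conv_lhs => rw [fourierMode_momentum_star_shift, fourierMode_momentum_star_shift,
    smul_mul_assoc, mul_smul_comm, smul_smul, h1, one_smul]
  rw [fourierMode_momentum_star, fourierMode_momentum_star]
  simp only [smul_mul_assoc, mul_smul_comm, Finset.sum_mul, Finset.mul_sum, smul_mulVec,
    mulVec_smul, sum_mulVec, mulVec_sum]
  refine congrArg _ (Finset.sum_congr rfl fun i _ => congrArg _ (congrArg _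
    (Finset.sum_congr rfl fun j _ => congrArg _ ?_)))
  rw [jordanWigner_conjTranspose, jordanWigner_conjTranspose, jordanWigner_conjTranspose,
    jordanWigner_conjTranspose, jw_jw_translation offDiagonal_pauliPlus.conjTranspose
      offDiagonal_pauliPlus.conjTranspose _ _ hψ]

/-- The indices of the momenta between `0` and `π`. -/
def positiveIndices (N : ℕ) [NeZero N] : List (Fin N) :=
  List.ofFn fun k : Fin ((N - 1) / 2) => Fin.ofNat N (k.val + 1)

theorem mem_positiveIndices {k : Fin N} :
    k ∈ positiveIndices N ↔ 1 ≤ k.val ∧ k.val ≤ (N - 1) / 2 := by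
  rw [positiveIndices, List.mem_ofFn]
  constructor
  · rintro ⟨l, rfl⟩
    have := l.isLt
    rw [Fin.val_ofNat, Nat.mod_eq_of_lt (by omega)]
    omega
  · rintro ⟨h1, h2⟩
    refine ⟨⟨k.val - 1, by omega⟩, ?_⟩
    ext
    simp only [Fin.val_ofNat]
    rw [Nat.mod_eq_of_lt (by omega)]
    omega

theorem nodup_positiveIndices : (positiveIndices N).Nodup := by
  rw [positiveIndices, List.nodup_ofFn]
  intro k l h
  have := congrArg Fin.val h
  simp only [Fin.val_ofNat] at this
  rw [Nat.mod_eq_of_lt (by omega), Nat.mod_eq_of_lt (by omega)] at this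
  exact Fin.ext (by omega)

theorem val_neg_of_ne_zero {k : Fin N} (h : k.val ≠ 0) : (-k : Fin N).val = N - k.val := by
  rw [Fin.val_neg, if_neg]
  rintro rfl
  simp at h

theorem neg_notMem_positiveIndices {k : Fin N} (h : k ∈ positiveIndices N) :
    -k ∉ positiveIndices N := by
  rw [mem_positiveIndices] at h ⊢
  rw [val_neg_of_ne_zero (by omega)]
  omega

theorem mem_positiveIndices_or (hN : Odd N) {k : Fin N} (h : k ≠ 0) :
    k ∈ positiveIndices N ∨ -k ∈ positiveIndices N := by
  have h0 : k.val ≠ 0 := fun e => h (Fin.ext (by simpa using e))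
  rw [mem_positiveIndices, mem_positiveIndices, val_neg_of_ne_zero h0]
  obtain ⟨m, hm⟩ := hN
  have := k.isLt
  omega

theorem vacuum_eq (n : ℕ) (lam : ℝ) : vacuum N n lam =
    ((positiveIndices N).map (pairFactor (fun k => fourierMode N (momentum k))
      fun k => bogoliubovAngle n lam (momentum k))).prod *ᵥ allUp N := by
  rw [vacuum, positiveIndices, List.map_ofFn]
  congr 3
  funext k
  have hk : momentum (Fin.ofNat N (k.val + 1)) = 2 * Real.pi * (k.val + 1 : ℕ) / N := by
    rw [momentum, Fin.val_ofNat, Nat.mod_eq_of_lt (by omega)]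
  simp only [Function.comp_apply, pairFactor, ← fourierMode_neg_momentum, hk]

theorem isPartialVacuum_vacuum (n : ℕ) (lam : ℝ) :
    IsPartialVacuum (fun k => fourierMode N (momentum k))
      (fun k => bogoliubovAngle n lam (momentum k)) (translation N) (parityZ N)
      (positiveIndices N) (vacuum N n lam) := by
  rw [vacuum_eq]
  refine car_fourierMode.isPartialVacuum_prod (sin_bogoliubovAngle_add_neg n lam)
    (fun k => parityZ_mul_fourierMode _)
    (fun k => parityZ_mul_star_of_anticomm (parityZ_mul_fourierMode _))
    translation_mulVec_pair
    ⟨?_, parityZ_mulVec_allUp, fun p _ _ => fourierMode_mulVec_allUp _,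
      fun p _ _ => translation_mulVec_fourierMode_allUp p, by simp, by simp⟩
    nodup_positiveIndices fun k => neg_notMem_positiveIndices
  intro h
  simpa [allUp] using congrFun h fun _ => 0

variable (hN : Odd N) (n : ℕ) {lam : ℝ} (hlam : -1 < lam)

include hN hlam

theorem bogoliubovMode_mulVec_vacuum (k : Fin N) :
    bogoliubovMode N n lam (momentum k) *ᵥ vacuum N n lam = 0 := by
  by_cases hk : k = 0
  -- The mode `0` is its own partner and belongs to no pair; it stays bare in the vacuum.
  · rw [bogoliubovMode_momentum hN n hlam, hk, bogoliubovAngle_zero n hlam]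
    have := (isPartialVacuum_vacuum (N := N) n lam).bare 0 (by simp [mem_positiveIndices])
      (by simp [mem_positiveIndices])
    simpa using this
  · rw [bogoliubovMode_momentum hN n hlam]
    exact (isPartialVacuum_vacuum n lam).dressed k (mem_positiveIndices_or hN hk)

theorem translation_mulVec_singleMode (k : Fin N) :
    translation N *ᵥ singleMode N n lam (momentum k) =
      phase k 1 • singleMode N n lam (momentum k) := by
  rw [singleMode, bogoliubovMode_momentum hN n hlam]
  by_cases hk : k = 0
  · rw [hk, bogoliubovAngle_zero n hlam]
    have := (isPartialVacuum_vacuum (N := N) n lam).bare_translation 0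
      (by simp [mem_positiveIndices]) (by simp [mem_positiveIndices])
    simpa using this
  · exact (isPartialVacuum_vacuum n lam).dressed_translation k (mem_positiveIndices_or hN hk)

theorem parityZ_mul_bogoliubovMode (k : Fin N) :
    parityZ N * bogoliubovMode N n lam (momentum k) =
      -(bogoliubovMode N n lam (momentum k) * parityZ N) := by
  rw [bogoliubovMode_momentum hN n hlam, mul_add, mul_smul_comm, mul_smul_comm,
    parityZ_mul_fourierMode, parityZ_mul_star_of_anticomm (parityZ_mul_fourierMode _), add_mul,
    smul_mul_assoc, smul_mul_assoc, neg_add, smul_neg, smul_neg]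

end

end

/-! ### Fock states as a basis, and the odd sector with its image under `Π^x`. -/

section

open Matrix

section Fock

variable {N : ℕ} {d : Fin N → Op N} {v : State N}

/-- The Fock state with the modes in the list `L` occupied over the vacuum `v`. -/
def fockState (d : Fin N → Op N) (v : State N) (L : List (Fin N)) : State N :=
  (L.map fun k => (d k)ᴴ).prod *ᵥ v

theorem fockState_cons (a : Fin N) (L : List (Fin N)) :
    fockState d v (a :: L) = (d a)ᴴ *ᵥ fockState d v L := by
  rw [fockState, List.map_cons, List.prod_cons, ← mulVec_mulVec, fockState]

theorem CAR.number_mul_star (hd : CAR d) {k a : Fin N} (h : k ≠ a) :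
    (d k)ᴴ * d k * (d a)ᴴ = (d a)ᴴ * ((d k)ᴴ * d k) := by
  rw [mul_assoc, hd.mul_star_swap h, mul_neg, ← mul_assoc, hd.star_mul_swap, neg_mul, neg_neg,
    mul_assoc]

theorem CAR.number_mul_star_self (hd : CAR d) (k : Fin N) :
    (d k)ᴴ * d k * (d k)ᴴ = (d k)ᴴ := by
  rw [mul_assoc, hd.mul_star_self, mul_sub, mul_one, ← mul_assoc, hd.star_mul_star_self, zero_mul,
    sub_zero]

theorem CAR.number_mulVec_fockState (hd : CAR d) (hv : ∀ k, d k *ᵥ v = 0) (k : Fin N)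
    (L : List (Fin N)) :
    ((d k)ᴴ * d k) *ᵥ fockState d v L = if k ∈ L then fockState d v L else 0 := by
  induction L with
  | nil => simp [fockState, ← mulVec_mulVec, hv]
  | cons a L ih =>
    rw [fockState_cons, mulVec_mulVec]
    by_cases h : k = a
    · subst h
      rw [hd.number_mul_star_self, if_pos List.mem_cons_self]
    · rw [hd.number_mul_star h, ← mulVec_mulVec, ih]
      simp only [List.mem_cons, h, false_or]
      split_ifs <;> simp

theorem CAR.fockState_ne_zero (hd : CAR d) (hv : ∀ k, d k *ᵥ v = 0) (hv0 : v ≠ 0)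
    {L : List (Fin N)} (hL : L.Nodup) : fockState d v L ≠ 0 := by
  induction L with
  | nil => simpa [fockState] using hv0
  | cons a L ih =>
    rw [List.nodup_cons] at hL
    intro h
    refine ih hL.2 ?_
    have h' := congrArg (fun ψ => d a *ᵥ ψ) h
    rwa [fockState_cons, mulVec_mulVec, hd.mul_star_self, sub_mulVec, one_mulVec,
      hd.number_mulVec_fockState hv, if_neg hL.1, sub_zero, mulVec_zero] at h'

/-- Uniqueness of binary expansions. -/
theorem sum_two_pow_injective :
    Function.Injective fun S : Finset (Fin N) => ((∑ k ∈ S, 2 ^ k.val : ℕ) : ℂ) := by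
  intro S S' h
  have h1 : ∑ k ∈ S, 2 ^ k.val = ∑ k ∈ S', 2 ^ k.val := Nat.cast_injective (R := ℂ) h
  refine Finset.map_injective Fin.valEmbedding (Finset.geomSum_injective (le_refl 2) ?_)
  simpa [Finset.sum_map] using h1

/-- The single operator `∑ 2^k d_k† d_k` separates the Fock states, since its eigenvalue encodes the
occupied set in binary. -/
theorem CAR.linearIndependent_fockState (hd : CAR d) (hv : ∀ k, d k *ᵥ v = 0) (hv0 : v ≠ 0) :
    LinearIndependent ℂ fun S : Finset (Fin N) => fockState d v S.toList := by
  refine Module.End.eigenvectors_linearIndependent'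
    (Matrix.toLin' (∑ k : Fin N, (2 ^ k.val : ℂ) • ((d k)ᴴ * d k))) _ sum_two_pow_injective _
    fun S => ?_
  rw [Module.End.hasEigenvector_iff, Module.End.mem_eigenspace_iff, Matrix.toLin'_apply]
  refine ⟨?_, hd.fockState_ne_zero hv hv0 S.nodup_toList⟩
  simp only [sum_mulVec, smul_mulVec, hd.number_mulVec_fockState hv, Finset.mem_toList, smul_ite,
    smul_zero]
  rw [Finset.sum_ite_mem, Finset.univ_inter, ← Finset.sum_smul]
  push_cast
  rfl

theorem CAR.span_fockState (hd : CAR d) (hv : ∀ k, d k *ᵥ v = 0) (hv0 : v ≠ 0) :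
    Submodule.span ℂ (Set.range fun S : Finset (Fin N) => fockState d v S.toList) = ⊤ := by
  refine (hd.linearIndependent_fockState hv hv0).span_eq_top_of_card_eq_finrank ?_
  simp

theorem parityZ_mulVec_fockState (hZ : ∀ k, parityZ N * d k = -(d k * parityZ N))
    (hZv : parityZ N *ᵥ v = v) (L : List (Fin N)) :
    parityZ N *ᵥ fockState d v L = (-1 : ℂ) ^ L.length • fockState d v L := by
  induction L with
  | nil => simp [fockState, hZv]
  | cons a L ih =>
    rw [fockState_cons, mulVec_mulVec, parityZ_mul_star_of_anticomm (hZ a), neg_mulVec,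
      ← mulVec_mulVec, ih, mulVec_smul, List.length_cons, pow_succ, mul_neg_one, neg_smul]

/-- The sets of an odd number of modes. -/
abbrev OddSet (N : ℕ) : Type := {S : Finset (Fin N) // Odd S.card}

theorem parityZ_mulVec_fockState_odd (hZ : ∀ k, parityZ N * d k = -(d k * parityZ N))
    (hZv : parityZ N *ᵥ v = v) (S : OddSet N) :
    parityZ N *ᵥ fockState d v S.1.toList = -fockState d v S.1.toList := by
  rw [parityZ_mulVec_fockState hZ hZv, Finset.length_toList, S.2.neg_one_pow, neg_one_smul]

/-- An odd vector is fixed by `(1 - Π^z)/2`, which kills the even Fock states and fixes the odd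
ones. -/
theorem CAR.mem_span_fockState_odd (hd : CAR d) (hv : ∀ k, d k *ᵥ v = 0) (hv0 : v ≠ 0)
    (hZ : ∀ k, parityZ N * d k = -(d k * parityZ N)) (hZv : parityZ N *ᵥ v = v)
    {ψ : State N} (hψ : parityZ N *ᵥ ψ = -ψ) :
    ψ ∈ Submodule.span ℂ (Set.range fun S : OddSet N => fockState d v S.1.toList) := by
  have h : ∀ φ ∈ Submodule.span ℂ (Set.range fun S : Finset (Fin N) => fockState d v S.toList),
      φ - parityZ N *ᵥ φ ∈
        Submodule.span ℂ (Set.range fun S : OddSet N => fockState d v S.1.toList) := by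
    intro φ hφ
    induction hφ using Submodule.span_induction with
    | mem x hx =>
      obtain ⟨S, rfl⟩ := hx
      simp only [parityZ_mulVec_fockState hZ hZv, Finset.length_toList]
      rcases Nat.even_or_odd S.card with hS | hS
      · rw [hS.neg_one_pow, one_smul, sub_self]
        exact Submodule.zero_mem _
      · rw [hS.neg_one_pow, neg_one_smul, sub_neg_eq_add]
        have : fockState d v S.toList ∈
            Submodule.span ℂ (Set.range fun S : OddSet N => fockState d v S.1.toList) :=
          Submodule.subset_span ⟨⟨S, hS⟩, rfl⟩
        exact Submodule.add_mem _ this this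
    | zero => simp
    | add x y _ _ hx hy =>
      rw [mulVec_add, add_sub_add_comm]
      exact Submodule.add_mem _ hx hy
    | smul a x _ hx =>
      rw [mulVec_smul, ← smul_sub]
      exact Submodule.smul_mem _ a hx
  have h2 := Submodule.smul_mem _ (1 / 2 : ℂ)
    (h ψ (by rw [hd.span_fockState hv hv0]; exact Submodule.mem_top))
  rw [hψ] at h2
  convert h2 using 1
  module

/-- The Fock states of odd fermion number and their images under `Π^x`. -/
def oddFockFamily (d : Fin N → Op N) (v : State N) : OddSet N ⊕ OddSet N → State N :=
  Sum.elim (fun S => fockState d v S.1.toList) (fun S => parityX N *ᵥ fockState d v S.1.toList)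

theorem parityX_mulVec_parityX (ψ : State N) : parityX N *ᵥ (parityX N *ᵥ ψ) = ψ := by
  rw [mulVec_mulVec, parityX_mul_self, one_mulVec]

theorem parityZ_mulVec_parityX (hN : Odd N) (ψ : State N) :
    parityZ N *ᵥ (parityX N *ᵥ ψ) = -(parityX N *ᵥ (parityZ N *ᵥ ψ)) := by
  rw [mulVec_mulVec, mulVec_mulVec, parityX_mul_parityZ hN, neg_mulVec, neg_neg]

/-- The two halves of the family lie in the eigenspaces `-1` and `+1` of `Π^z`. -/
theorem CAR.linearIndependent_oddFockFamily (hd : CAR d) (hv : ∀ k, d k *ᵥ v = 0) (hv0 : v ≠ 0)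
    (hN : Odd N) (hZ : ∀ k, parityZ N * d k = -(d k * parityZ N)) (hZv : parityZ N *ᵥ v = v) :
    LinearIndependent ℂ (oddFockFamily d v) := by
  have h1 : LinearIndependent ℂ fun S : OddSet N => fockState d v S.1.toList :=
    (hd.linearIndependent_fockState hv hv0).comp _ Subtype.val_injective
  have h2 : LinearIndependent ℂ
      fun S : OddSet N => parityX N *ᵥ fockState d v S.1.toList := by
    refine h1.map' (Matrix.toLin' (parityX N)) (LinearMap.ker_eq_bot_of_inverse
      (g := Matrix.toLin' (parityX N)) ?_)
    rw [← Matrix.toLin'_mul, parityX_mul_self, Matrix.toLin'_one]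
  refine h1.sum_type h2 ?_
  rw [Submodule.disjoint_def]
  intro x hx hx'
  have e1 : Submodule.span ℂ (Set.range fun S : OddSet N => fockState d v S.1.toList) ≤
      Module.End.eigenspace (Matrix.toLin' (parityZ N)) (-1) := by
    rw [Submodule.span_le]
    rintro _ ⟨S, rfl⟩
    rw [SetLike.mem_coe, Module.End.mem_eigenspace_iff, Matrix.toLin'_apply,
      parityZ_mulVec_fockState_odd hZ hZv, neg_one_smul]
  have e2 : Submodule.span ℂ
      (Set.range fun S : OddSet N => parityX N *ᵥ fockState d v S.1.toList) ≤
      Module.End.eigenspace (Matrix.toLin' (parityZ N)) 1 := by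
    rw [Submodule.span_le]
    rintro _ ⟨S, rfl⟩
    rw [SetLike.mem_coe, Module.End.mem_eigenspace_iff, Matrix.toLin'_apply,
      parityZ_mulVec_parityX hN, parityZ_mulVec_fockState_odd hZ hZv, one_smul, mulVec_neg, neg_neg]
  have f1 := Module.End.mem_eigenspace_iff.mp (e1 hx)
  have f2 := Module.End.mem_eigenspace_iff.mp (e2 hx')
  rw [f1, neg_one_smul, one_smul] at f2
  exact self_eq_neg.mp f2.symm

theorem CAR.span_oddFockFamily (hd : CAR d) (hv : ∀ k, d k *ᵥ v = 0) (hv0 : v ≠ 0)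
    (hN : Odd N) (hZ : ∀ k, parityZ N * d k = -(d k * parityZ N)) (hZv : parityZ N *ᵥ v = v) :
    ⊤ ≤ Submodule.span ℂ (Set.range (oddFockFamily d v)) := by
  intro ψ _
  have hodd : ∀ φ : State N, parityZ N *ᵥ φ = -φ →
      φ ∈ Submodule.span ℂ (Set.range (oddFockFamily d v)) := by
    intro φ hφ
    refine Submodule.span_mono ?_ (hd.mem_span_fockState_odd hv hv0 hZ hZv hφ)
    rintro _ ⟨S, rfl⟩
    exact ⟨Sum.inl S, rfl⟩
  have hX : ∀ φ : State N, parityZ N *ᵥ φ = -φ →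
      parityX N *ᵥ φ ∈ Submodule.span ℂ (Set.range (oddFockFamily d v)) := by
    intro φ hφ
    have := Submodule.mem_map_of_mem (f := Matrix.toLin' (parityX N))
      (hd.mem_span_fockState_odd hv hv0 hZ hZv hφ)
    rw [Submodule.map_span, Matrix.toLin'_apply] at this
    refine Submodule.span_mono ?_ this
    rintro _ ⟨_, ⟨S, rfl⟩, rfl⟩
    exact ⟨Sum.inr S, rfl⟩
  have hZZ : parityZ N *ᵥ (parityZ N *ᵥ ψ) = ψ := by
    rw [mulVec_mulVec, parityZ_mul_self, one_mulVec]
  have h1 := hodd (ψ - parityZ N *ᵥ ψ) (by rw [mulVec_sub, hZZ, neg_sub])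
  -- The even part of `ψ` is `Π^x` applied to an odd vector, namely to its own image under `Π^x`.
  have h2 := hX (parityX N *ᵥ (ψ + parityZ N *ᵥ ψ)) (by
    rw [parityZ_mulVec_parityX hN, mulVec_add, hZZ, add_comm])
  rw [parityX_mulVec_parityX] at h2
  have h3 := Submodule.smul_mem _ (1 / 2 : ℂ) (Submodule.add_mem _ h1 h2)
  convert h3 using 1
  module

end Fock

/-! ### Eigenspaces read off from an eigenbasis. -/

section Spectrum

variable {N : ℕ} {ι : Type*} {H : Op N} {E : ι → ℝ}

theorem eigenspace_eq_span (B : Module.Basis ι ℂ (State N))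
    (hB : ∀ i, H *ᵥ B i = (E i : ℂ) • B i) (μ : ℂ) :
    Module.End.eigenspace (Matrix.toLin' H) μ =
      Submodule.span ℂ (B '' {i | (E i : ℂ) = μ}) := by
  apply le_antisymm
  · intro ψ hψ
    rw [Module.End.mem_eigenspace_iff] at hψ
    rw [Module.Basis.mem_span_image]
    intro i hi
    rw [Finset.mem_coe, Finsupp.mem_support_iff] at hi
    -- Coordinate functionals are left eigenvectors, so a nonzero coordinate of an eigenvector
    -- forces the eigenvalues to agree.
    have hrepr : B.coord i ∘ₗ Matrix.toLin' H = (E i : ℂ) • B.coord i := by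
      refine B.ext fun j => ?_
      rw [LinearMap.comp_apply, Matrix.toLin'_apply, hB, LinearMap.smul_apply, map_smul,
        Module.Basis.coord_apply, Module.Basis.repr_self, smul_eq_mul, smul_eq_mul]
      by_cases hij : j = i
      · rw [hij]
      · rw [Finsupp.single_eq_of_ne (Ne.symm hij), mul_zero, mul_zero]
    have := LinearMap.congr_fun hrepr ψ
    rw [LinearMap.comp_apply, LinearMap.smul_apply, Module.Basis.coord_apply,
      Module.Basis.coord_apply, smul_eq_mul] at this
    rw [hψ, map_smul, Finsupp.smul_apply, smul_eq_mul] at this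
    exact (mul_right_cancel₀ hi this).symm
  · rw [Submodule.span_le]
    rintro _ ⟨i, hi, rfl⟩
    rw [SetLike.mem_coe, Module.End.mem_eigenspace_iff, Matrix.toLin'_apply, hB i, hi]

theorem energyLevels_eq_range (B : Module.Basis ι ℂ (State N))
    (hB : ∀ i, H *ᵥ B i = (E i : ℂ) • B i) : energyLevels H = Set.range E := by
  ext x
  rw [energyLevels, Set.mem_ofPred_eq, Module.End.hasEigenvalue_iff, eigenspace_eq_span B hB, ne_eq,
    Submodule.span_eq_bot]
  constructor
  · intro h
    push Not at h
    obtain ⟨_, ⟨i, hi, rfl⟩, _⟩ := h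
    exact ⟨i, by exact_mod_cast hi⟩
  · rintro ⟨i, rfl⟩ h
    exact B.ne_zero i (h _ ⟨i, rfl, rfl⟩)

end Spectrum

end

/-! ### The ground space: one particle at a momentum of minimal energy. -/

section

open Matrix

variable {N : ℕ} [NeZero N] {n : ℕ} {lam : ℝ}

theorem momenta_eq_range : momenta N = Set.range (momentum (N := N)) := by
  ext q
  constructor
  · rintro ⟨k, hk, rfl⟩
    exact ⟨⟨k, hk⟩, rfl⟩
  · rintro ⟨k, rfl⟩
    exact ⟨k.val, k.isLt, rfl⟩

theorem momentum_injective : Function.Injective (momentum (N := N)) := by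
  intro k l h
  have hN0 : (N : ℝ) ≠ 0 := Nat.cast_ne_zero.mpr (NeZero.ne N)
  rw [momentum, momentum, div_left_inj' hN0] at h
  have h2 := mul_left_cancel₀ Real.two_pi_pos.ne' h
  exact Fin.ext (by exact_mod_cast h2)

theorem momentum_mem_groundMomenta_iff {k : Fin N} : momentum k ∈ groundMomenta N n lam ↔
    ∀ l : Fin N, modeEnergy n lam (momentum k) ≤ modeEnergy n lam (momentum l) := by
  simp only [groundMomenta, Set.mem_ofPred_eq, momenta_eq_range, Set.mem_range, forall_exists_index,
    forall_apply_eq_imp_iff, exists_apply_eq_apply, true_and]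

/-- The index of a momentum of minimal energy. -/
def groundIndex (q : groundMomenta N n lam) : Fin N :=
  (momenta_eq_range.le q.2.1).choose

theorem momentum_groundIndex (q : groundMomenta N n lam) : momentum (groundIndex q) = q :=
  (momenta_eq_range.le q.2.1).choose_spec

/-- The energy of a state with the given occupied modes. -/
def occupationEnergy (n : ℕ) (lam : ℝ) (S : Finset (Fin N)) : ℝ :=
  ∑ k ∈ S, modeEnergy n lam (momentum k) - ∑ k : Fin N, modeEnergy n lam (momentum k) / 2

/-- The one-particle occupation at a momentum of minimal energy. -/
def groundOccupation (q : groundMomenta N n lam) : OddSet N :=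
  ⟨{groundIndex q}, by simp⟩

theorem groundOccupation_injective :
    Function.Injective (groundOccupation : groundMomenta N n lam → OddSet N) := by
  intro p q h
  have h' := Finset.singleton_injective (congrArg Subtype.val h)
  exact Subtype.ext (by rw [← momentum_groundIndex p, ← momentum_groundIndex q, h'])

/-- An odd set contains at least one mode, which costs at least the minimal energy, and every
further mode costs a strictly positive amount. -/
theorem occupationEnergy_eq_iff (hlam : lam ∈ Set.Ioo (-1 : ℝ) 1) {k₀ : Fin N}
    (hk₀ : ∀ l : Fin N, modeEnergy n lam (momentum k₀) ≤ modeEnergy n lam (momentum l))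
    (S : OddSet N) :
    occupationEnergy n lam {k₀} ≤ occupationEnergy n lam S.1 ∧
      (occupationEnergy n lam S.1 = occupationEnergy n lam {k₀} ↔
        S ∈ Set.range (groundOccupation : groundMomenta N n lam → OddSet N)) := by
  have hpos := modeEnergy_momentum_pos (N := N) n hlam
  obtain ⟨k, hk⟩ : S.1.Nonempty := by
    rw [← Finset.card_pos]
    exact S.2.pos
  have hsplit := Finset.add_sum_erase S.1 (fun k => modeEnergy n lam (momentum k)) hk
  have hrest : 0 ≤ ∑ l ∈ S.1.erase k, modeEnergy n lam (momentum l) :=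
    Finset.sum_nonneg fun l _ => (hpos l).le
  have h0 := hk₀ k
  refine ⟨?_, fun h => ?_, ?_⟩
  · rw [occupationEnergy, occupationEnergy, Finset.sum_singleton]
    linarith
  · rw [occupationEnergy, occupationEnergy, Finset.sum_singleton] at h
    have h1 : ∑ l ∈ S.1.erase k, modeEnergy n lam (momentum l) = 0 := by linarith
    have h2 : modeEnergy n lam (momentum k) = modeEnergy n lam (momentum k₀) := by linarith
    rw [Finset.sum_eq_zero_iff_of_nonneg fun l _ => (hpos l).le] at h1
    have h3 : S.1 = {k} := by
      ext l
      rw [Finset.mem_singleton]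
      refine ⟨fun hl => ?_, fun hl => hl ▸ hk⟩
      by_contra hne
      exact (hpos l).ne' (h1 l (Finset.mem_erase.mpr ⟨hne, hl⟩))
    have hmem : momentum k ∈ groundMomenta N n lam :=
      momentum_mem_groundMomenta_iff.mpr fun l => h2 ▸ hk₀ l
    have hidx : groundIndex ⟨momentum k, hmem⟩ = k := momentum_injective (momentum_groundIndex _)
    exact ⟨⟨momentum k, hmem⟩, Subtype.ext (by rw [h3, groundOccupation, hidx])⟩
  · rintro ⟨q, rfl⟩
    rw [occupationEnergy, occupationEnergy, groundOccupation, Finset.sum_singleton,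
      Finset.sum_singleton, momentum_groundIndex]
    congr 1
    refine le_antisymm (q.2.2 _ (momenta_eq_range.ge ⟨k₀, rfl⟩)) ?_
    rw [← momentum_groundIndex]
    exact hk₀ _

theorem oddHamiltonian_mulVec_fockState (hN : Odd N) (hlam : -1 < lam) (S : Finset (Fin N)) :
    oddHamiltonian N n lam *ᵥ fockState (fun k => bogoliubovMode N n lam (momentum k))
        (vacuum N n lam) S.toList =
      (occupationEnergy n lam S : ℂ) • fockState (fun k => bogoliubovMode N n lam (momentum k))
        (vacuum N n lam) S.toList := by
  rw [oddHamiltonian_eq hN n hlam]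
  have hnum := (car_bogoliubovMode hN n hlam).number_mulVec_fockState
    (bogoliubovMode_mulVec_vacuum hN n hlam)
  simp only [sum_mulVec, sub_mulVec, smul_mulVec, one_mulVec, hnum, Finset.mem_toList, smul_ite,
    smul_zero]
  rw [Finset.sum_sub_distrib, Finset.sum_ite_mem, Finset.univ_inter, ← Finset.sum_smul,
    ← Finset.sum_smul, ← sub_smul, occupationEnergy]
  push_cast
  rfl

theorem hamiltonian_mulVec_oddFockFamily (hN : Odd N) (hn : Even n) (hnN : n + 2 < N)
    (hlam : -1 < lam) (i : OddSet N ⊕ OddSet N) :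
    hamiltonian N n lam *ᵥ oddFockFamily (fun k => bogoliubovMode N n lam (momentum k))
        (vacuum N n lam) i =
      ((Sum.elim (fun S : OddSet N => occupationEnergy n lam S.1)
        (fun S : OddSet N => occupationEnergy n lam S.1) i : ℝ) : ℂ) •
        oddFockFamily (fun k => bogoliubovMode N n lam (momentum k)) (vacuum N n lam) i := by
  have h : ∀ S : OddSet N, hamiltonian N n lam *ᵥ
      fockState (fun k => bogoliubovMode N n lam (momentum k)) (vacuum N n lam) S.1.toList =
      (occupationEnergy n lam S.1 : ℂ) •
        fockState (fun k => bogoliubovMode N n lam (momentum k)) (vacuum N n lam) S.1.toList := by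
    intro S
    rw [hamiltonian_mulVec_of_odd hnN lam (parityZ_mulVec_fockState_odd
      (parityZ_mul_bogoliubovMode hN n hlam) (isPartialVacuum_vacuum n lam).parity S),
      oddHamiltonian_mulVec_fockState hN hlam]
  rcases i with S | S
  · exact h S
  · simp only [oddFockFamily, Sum.elim_inr]
    rw [mulVec_mulVec, ← parityX_mul_hamiltonian hn, ← mulVec_mulVec, h S, mulVec_smul]

/-- The proposed ground states are the members of the eigenbasis with a single occupied mode in `Q`,
so their independence is inherited. -/
theorem groundFamily_eq_comp : groundFamily N n lam =
    oddFockFamily (fun k => bogoliubovMode N n lam (momentum k)) (vacuum N n lam) ∘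
      Sum.map groundOccupation groundOccupation := by
  have h : ∀ q : groundMomenta N n lam,
      fockState (fun k => bogoliubovMode N n lam (momentum k)) (vacuum N n lam)
        (groundOccupation q).1.toList = singleMode N n lam q := by
    intro q
    simp [groundOccupation, Finset.toList_singleton, fockState, singleMode, momentum_groundIndex]
  funext i
  rcases i with q | q <;> simp [groundFamily, oddFockFamily, h]

theorem linearIndependent_groundFamily (hN : Odd N) (hlam : -1 < lam) :
    LinearIndependent ℂ (groundFamily N n lam) := by
  rw [groundFamily_eq_comp]
  exact ((car_bogoliubovMode hN n hlam).linearIndependent_oddFockFamily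
    (bogoliubovMode_mulVec_vacuum hN n hlam) (isPartialVacuum_vacuum n lam).ne_zero hN
    (parityZ_mul_bogoliubovMode hN n hlam) (isPartialVacuum_vacuum n lam).parity).comp _
    (groundOccupation_injective.sumMap groundOccupation_injective)

/-- The eigenbasis determines both the set of levels and the eigenspaces. The infimum defining the
ground energy is attained, so it is a genuine lowest level. -/
theorem isLeast_groundEnergy_and_span (hN : Odd N) (hn : Even n) (hnN : n + 2 < N)
    (hlam : lam ∈ Set.Ioo (-1 : ℝ) 1) :
    IsLeast (energyLevels (hamiltonian N n lam)) (groundEnergy (hamiltonian N n lam)) ∧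
      Submodule.span ℂ (Set.range (groundFamily N n lam)) =
        groundSpace (hamiltonian N n lam) := by
  have hd := car_bogoliubovMode hN n hlam.1
  have hv := bogoliubovMode_mulVec_vacuum hN n hlam.1
  have hw := isPartialVacuum_vacuum (N := N) n lam
  have hZ := parityZ_mul_bogoliubovMode hN n hlam.1
  let B : Module.Basis (OddSet N ⊕ OddSet N) ℂ (State N) := Module.Basis.mk
    (hd.linearIndependent_oddFockFamily hv hw.ne_zero hN hZ hw.parity)
    (hd.span_oddFockFamily hv hw.ne_zero hN hZ hw.parity)
  have hB : ⇑B = oddFockFamily (fun k => bogoliubovMode N n lam (momentum k)) (vacuum N n lam) :=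
    Module.Basis.coe_mk _ _
  let E : OddSet N ⊕ OddSet N → ℝ := Sum.elim (fun S => occupationEnergy n lam S.1)
    (fun S => occupationEnergy n lam S.1)
  have hE : ∀ i, hamiltonian N n lam *ᵥ B i = (E i : ℂ) • B i := by
    intro i
    rw [hB]
    exact hamiltonian_mulVec_oddFockFamily hN hn hnN hlam.1 i
  obtain ⟨k₀, hk₀⟩ := Finite.exists_min fun k : Fin N => modeEnergy n lam (momentum k)
  have key := occupationEnergy_eq_iff hlam hk₀
  have hleast : IsLeast (energyLevels (hamiltonian N n lam)) (occupationEnergy n lam {k₀}) := by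
    rw [energyLevels_eq_range B hE]
    refine ⟨⟨Sum.inl ⟨{k₀}, by simp⟩, rfl⟩, ?_⟩
    rintro _ ⟨S | S, rfl⟩
    exacts [(key S).1, (key S).1]
  have hg : groundEnergy (hamiltonian N n lam) = occupationEnergy n lam {k₀} := hleast.csInf_eq
  refine ⟨hg ▸ hleast, ?_⟩
  rw [groundSpace, eigenspace_eq_span B hE, hg, groundFamily_eq_comp, hB, Set.range_comp]
  congr 2
  ext i
  simp only [Set.mem_ofPred_eq, Complex.ofReal_inj, Set.mem_range]
  rcases i with S | S
  · refine Iff.trans ?_ (key S).2.symm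
    constructor
    · rintro ⟨q | q, hq⟩
      · exact ⟨q, Sum.inl_injective hq⟩
      · simp at hq
    · rintro ⟨q, rfl⟩
      exact ⟨Sum.inl q, rfl⟩
  · refine Iff.trans ?_ (key S).2.symm
    constructor
    · rintro ⟨q | q, hq⟩
      · simp at hq
      · exact ⟨q, Sum.inr_injective hq⟩
    · rintro ⟨q, rfl⟩
      exact ⟨Sum.inr q, rfl⟩

theorem finite_groundMomenta : (groundMomenta N n lam).Finite :=
  (momenta_eq_range (N := N) ▸ Set.finite_range _ : (momenta N).Finite).subset fun _ h => h.1

theorem finrank_groundSpace (hN : Odd N) (hn : Even n) (hnN : n + 2 < N)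
    (hlam : lam ∈ Set.Ioo (-1 : ℝ) 1) :
    Module.finrank ℂ (groundSpace (hamiltonian N n lam)) = 2 * (groundMomenta N n lam).ncard := by
  have := (finite_groundMomenta (N := N) (n := n) (lam := lam)).fintype
  rw [← (isLeast_groundEnergy_and_span hN hn hnN hlam).2,
    finrank_span_eq_card (linearIndependent_groundFamily hN hlam.1), Fintype.card_sum,
    ← Nat.card_coe_set_eq, Nat.card_eq_fintype_card, two_mul]

theorem translation_mulVec_of_mem_groundMomenta (hN : Odd N) (hlam : -1 < lam) {q : ℝ}
    (hq : q ∈ groundMomenta N n lam) :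
    translation N *ᵥ singleMode N n lam q = Complex.exp (Complex.I * q) • singleMode N n lam q ∧
      translation N *ᵥ (parityX N *ᵥ singleMode N n lam q) =
        Complex.exp (Complex.I * q) • (parityX N *ᵥ singleMode N n lam q) := by
  have h : translation N *ᵥ singleMode N n lam q =
      Complex.exp (Complex.I * q) • singleMode N n lam q := by
    obtain ⟨k, rfl⟩ := momenta_eq_range.le hq.1
    rw [translation_mulVec_singleMode hN n hlam, phase]
    simp
  refine ⟨h, ?_⟩
  rw [mulVec_mulVec, ← parityX_mul_translation, ← mulVec_mulVec, h, mulVec_smul]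

end

/-! ### Arithmetic of the momenta of minimal energy. -/

section

section Arithmetic

/-- As `m` is invertible modulo `M`, the condition singles out one residue class of `k`, which meets
each of the `g` blocks of length `M` once. -/
theorem count_mul_modEq {m M : ℕ} (g r : ℕ) (hM : 0 < M) (h : Nat.Coprime m M) :
    ((Finset.range (g * M)).filter fun k => m * k ≡ r [MOD M]).card = g := by
  obtain ⟨c, _, hc⟩ := Nat.exists_mul_mod_eq_of_coprime r h hM.ne'
  have hiff : ∀ k, m * k ≡ r [MOD M] ↔ k ≡ c [MOD M] := fun k =>
    ⟨fun hk => Nat.ModEq.cancel_left_of_coprime (Nat.coprime_comm.mp h) (hk.trans hc.symm),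
      fun hk => (hk.mul_left m).trans hc⟩
  simp only [hiff]
  rw [← Nat.count_eq_card_filter_range, Nat.count_modEq_card _ hM, Nat.mul_div_cancel _ hM,
    Nat.mul_mod_left]
  simp

theorem cos_two_pi_mul_div_eq_one_iff {M : ℕ} (hM : 0 < M) (a : ℕ) :
    Real.cos (2 * Real.pi * a / M) = 1 ↔ a ≡ 0 [MOD M] := by
  have hM' : (M : ℝ) ≠ 0 := Nat.cast_ne_zero.mpr hM.ne'
  rw [Real.cos_eq_one_iff, Nat.modEq_zero_iff_dvd, ← Int.natCast_dvd_natCast]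
  constructor
  · rintro ⟨z, hz⟩
    rw [eq_div_iff hM'] at hz
    have : (a : ℝ) = M * z := by
      apply mul_left_cancel₀ Real.two_pi_pos.ne'
      linarith
    exact ⟨z, by exact_mod_cast this⟩
  · rintro ⟨z, hz⟩
    have : (a : ℝ) = M * z := by exact_mod_cast hz
    refine ⟨z, ?_⟩
    rw [this]
    field_simp

theorem pi_sub_pi_div (h : ℕ) :
    Real.pi - Real.pi / (2 * h + 1 : ℕ) = 2 * Real.pi * h / (2 * h + 1 : ℕ) := by
  have hM' : ((2 * h + 1 : ℕ) : ℝ) ≠ 0 := by positivity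
  field_simp
  push_cast
  ring

theorem cos_two_pi_mul_div_mod {M : ℕ} (hM : 0 < M) (a : ℕ) :
    Real.cos (2 * Real.pi * a / M) = Real.cos (2 * Real.pi * (a % M : ℕ) / M) := by
  have hM' : (M : ℝ) ≠ 0 := Nat.cast_ne_zero.mpr hM.ne'
  have h : (a : ℝ) = (a % M : ℕ) + M * (a / M : ℕ) := by exact_mod_cast (Nat.mod_add_div a M).symm
  rw [← Real.cos_add_nat_mul_two_pi (2 * Real.pi * (a % M : ℕ) / M) (a / M)]
  congr 1
  rw [h]
  field_simp

theorem cos_two_pi_mul_div_symm {M a : ℕ} (hM : 0 < M) (ha : a ≤ M) :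
    Real.cos (2 * Real.pi * (M - a : ℕ) / M) = Real.cos (2 * Real.pi * a / M) := by
  have hM' : (M : ℝ) ≠ 0 := Nat.cast_ne_zero.mpr hM.ne'
  rw [← Real.cos_two_pi_sub]
  congr 1
  rw [Nat.cast_sub ha]
  field_simp
  ring

theorem neg_cos_pi_div_eq (h : ℕ) : -Real.cos (Real.pi / (2 * h + 1 : ℕ)) =
    Real.cos (2 * Real.pi * h / (2 * h + 1 : ℕ)) := by
  rw [← Real.cos_pi_sub, pi_sub_pi_div]

theorem mul_div_mem_Icc {h a : ℕ} (ha : a ≤ h) :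
    2 * Real.pi * a / (2 * h + 1 : ℕ) ∈ Set.Icc 0 Real.pi := by
  have hM' : (0 : ℝ) < ((2 * h + 1 : ℕ) : ℝ) := by positivity
  have ha' : (a : ℝ) ≤ h := by exact_mod_cast ha
  have := Real.pi_pos
  refine ⟨by positivity, ?_⟩
  rw [div_le_iff₀ hM']
  push_cast
  nlinarith

/-- The angles `2πa/(2h+1)` with `a ≤ h` lie in `[0, π]`, where the cosine strictly decreases; the
largest one is `π - π/(2h+1)`. -/
theorem neg_cos_pi_div_le_of_le {h a : ℕ} (ha : a ≤ h) :
    -Real.cos (Real.pi / (2 * h + 1 : ℕ)) ≤ Real.cos (2 * Real.pi * a / (2 * h + 1 : ℕ)) ∧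
      (Real.cos (2 * Real.pi * a / (2 * h + 1 : ℕ)) =
        -Real.cos (Real.pi / (2 * h + 1 : ℕ)) ↔ a = h) := by
  rw [neg_cos_pi_div_eq]
  have hM' : ((2 * h + 1 : ℕ) : ℝ) ≠ 0 := by positivity
  have h1 := mul_div_mem_Icc ha
  have h2 := mul_div_mem_Icc (le_refl h)
  refine ⟨Real.strictAntiOn_cos.antitoneOn h1 h2 ?_, fun e => ?_, fun e => by rw [e]⟩
  · have := Real.pi_pos
    gcongr
  · have := Real.injOn_cos h1 h2 e
    rw [div_left_inj' hM'] at this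
    exact_mod_cast mul_left_cancel₀ Real.two_pi_pos.ne' this

/-- For odd `M = 2h + 1` the numbers `cos (2πa/M)` are at least `-cos (π/M)`. -/
theorem neg_cos_pi_div_le (h a : ℕ) :
    -Real.cos (Real.pi / (2 * h + 1 : ℕ)) ≤ Real.cos (2 * Real.pi * a / (2 * h + 1 : ℕ)) ∧
      (Real.cos (2 * Real.pi * a / (2 * h + 1 : ℕ)) =
        -Real.cos (Real.pi / (2 * h + 1 : ℕ)) ↔
          a ≡ h [MOD 2 * h + 1] ∨ a ≡ h + 1 [MOD 2 * h + 1]) := by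
  have hM : 0 < 2 * h + 1 := by omega
  have hlt := Nat.mod_lt a hM
  rw [cos_two_pi_mul_div_mod hM, Nat.ModEq, Nat.ModEq]
  generalize a % (2 * h + 1) = b at *
  -- For `h = 0` the modulus is `1`: both congruences hold trivially and both sides equal `1`.
  rcases Nat.eq_zero_or_pos h with rfl | hpos
  · obtain rfl : b = 0 := by omega
    simp
  rw [Nat.mod_eq_of_lt (show h < 2 * h + 1 by omega),
    Nat.mod_eq_of_lt (show h + 1 < 2 * h + 1 by omega)]
  rcases le_or_gt b h with hb | hb
  · obtain ⟨h1, h2⟩ := neg_cos_pi_div_le_of_le hb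
    refine ⟨h1, h2.trans ?_⟩
    omega
  -- Residues above `h` are reflected to `2h + 1 - b`, so that the residue `h + 1` corresponds to
  -- `h`.
  · rw [← cos_two_pi_mul_div_symm hM hlt.le]
    obtain ⟨h1, h2⟩ := neg_cos_pi_div_le_of_le (show 2 * h + 1 - b ≤ h by omega)
    refine ⟨h1, h2.trans ?_⟩
    omega

end Arithmetic

variable {N : ℕ} [NeZero N] {n : ℕ} {lam : ℝ}

/-- Comes from `|1 + λ e^{ix}|² = 1 + λ² + 2λ cos x` with `x = (n+2)q`. -/
theorem modeEnergy_le_iff (h : -1 < lam) (k l : Fin N) :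
    modeEnergy n lam (momentum k) ≤ modeEnergy n lam (momentum l) ↔
      lam * Real.cos (((n : ℝ) + 2) * momentum k) ≤
        lam * Real.cos (((n : ℝ) + 2) * momentum l) := by
  have hsq : ∀ x : ℝ, ‖(1 : ℂ) + lam * Complex.exp (Complex.I * ((n : ℂ) + 2) * x)‖ ^ 2 =
      1 + lam ^ 2 + 2 * (lam * Real.cos (((n : ℝ) + 2) * x)) := by
    intro x
    have e : Complex.I * ((n : ℂ) + 2) * x = (((n : ℝ) + 2) * x : ℝ) * Complex.I := by
      push_cast; ring
    rw [e, Complex.exp_mul_I, ← Complex.ofReal_cos, ← Complex.ofReal_sin, Complex.sq_norm,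
      Complex.normSq_apply]
    have := Real.sin_sq_add_cos_sq (((n : ℝ) + 2) * x)
    simp only [Complex.add_re, Complex.one_re, Complex.mul_re, Complex.ofReal_re, Complex.I_re,
      Complex.ofReal_im, Complex.I_im, Complex.add_im, Complex.one_im, Complex.mul_im]
    linear_combination lam ^ 2 * this
  rw [modeEnergy_momentum n h, modeEnergy_momentum n h, norm_hSymbol, norm_hSymbol,
    mul_le_mul_iff_right₀ two_pos, ← sq_le_sq₀ (norm_nonneg _) (norm_nonneg _), hsq, hsq]
  constructor <;> intro h <;> linarith

theorem mem_groundMomenta_iff (h : -1 < lam) {q : ℝ} : q ∈ groundMomenta N n lam ↔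
    q ∈ momenta N ∧ ∀ l : Fin N, lam * Real.cos (((n : ℝ) + 2) * q) ≤
      lam * Real.cos (((n : ℝ) + 2) * momentum l) := by
  constructor
  · intro hq
    refine ⟨hq.1, ?_⟩
    obtain ⟨k, rfl⟩ := momenta_eq_range.le hq.1
    exact fun l => (modeEnergy_le_iff h k l).mp (momentum_mem_groundMomenta_iff.mp hq l)
  · rintro ⟨hq, hl⟩
    obtain ⟨k, rfl⟩ := momenta_eq_range.le hq
    exact momentum_mem_groundMomenta_iff.mpr fun l => (modeEnergy_le_iff h k l).mpr (hl l)

theorem groundMomenta_of_neg (h : lam ∈ Set.Ioo (-1 : ℝ) 0) : groundMomenta N n lam =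
    {q | q ∈ momenta N ∧ Real.cos (((n : ℝ) + 2) * q) = 1} := by
  ext q
  rw [mem_groundMomenta_iff h.1, Set.mem_ofPred_eq]
  refine and_congr_right fun _ => ⟨fun hl => ?_, fun hq l => ?_⟩
  · have h0 := hl 0
    rw [(momentum_eq_zero_iff (0 : Fin N)).mpr rfl, mul_zero, Real.cos_zero,
      mul_le_mul_left_of_neg h.2] at h0
    exact le_antisymm (Real.cos_le_one _) h0
  · rw [hq, mul_le_mul_left_of_neg h.2]
    exact Real.cos_le_one _

/-- The arithmetic of the momenta: `g = gcd(N, n+2)`, `N = g (2h + 1)`, `n + 2 = g m`. -/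
theorem exists_gcd_decomposition (hN : Odd N) (hnN : n + 2 < N) : ∃ h m : ℕ, 0 < h ∧
    N = Nat.gcd N (n + 2) * (2 * h + 1) ∧ n + 2 = Nat.gcd N (n + 2) * m ∧
      Nat.Coprime m (2 * h + 1) := by
  have hg : 0 < Nat.gcd N (n + 2) := Nat.gcd_pos_of_pos_right _ (by omega)
  obtain ⟨M, hM⟩ := Nat.gcd_dvd_left N (n + 2)
  obtain ⟨m, hm⟩ := Nat.gcd_dvd_right N (n + 2)
  have hodd : Odd M := by
    rw [hM] at hN
    exact (Nat.odd_mul.mp hN).2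
  obtain ⟨h, rfl⟩ := hodd
  refine ⟨h, m, ?_, hM, hm, ?_⟩
  · rcases Nat.eq_zero_or_pos h with rfl | hpos
    -- If `h = 0` the gcd would be `N`, but it is at most `n + 2 < N`.
    · have := Nat.gcd_le_right N (show 0 < n + 2 by omega)
      omega
    · exact hpos
  · have := Nat.coprime_div_gcd_div_gcd hg
    rw [Nat.coprime_comm]
    rwa [Nat.div_eq_of_eq_mul_right hg hM, Nat.div_eq_of_eq_mul_right hg hm] at this

theorem add_two_mul_div_eq {g M m : ℕ} (hg : 0 < g) (hm : n + 2 = g * m) (k : ℕ) :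
    ((n : ℝ) + 2) * (2 * Real.pi * k / (g * M : ℕ)) = 2 * Real.pi * (m * k : ℕ) / M := by
  have h1 : (n : ℝ) + 2 = g * m := by exact_mod_cast hm
  have h2 : (g : ℝ) ≠ 0 := Nat.cast_ne_zero.mpr hg.ne'
  rw [h1]
  push_cast
  rcases eq_or_ne (M : ℝ) 0 with h3 | h3
  · simp [h3]
  · field_simp

theorem ncard_momenta_filter {P : ℕ → Prop} [DecidablePred P] {φ : ℝ → Prop}
    (h : ∀ k : ℕ, φ (2 * Real.pi * k / N) ↔ P k) :
    {q | q ∈ momenta N ∧ φ q}.ncard = ((Finset.range N).filter P).card := by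
  have hN0 : (N : ℝ) ≠ 0 := Nat.cast_ne_zero.mpr (NeZero.ne N)
  have hinj : Function.Injective fun k : ℕ => 2 * Real.pi * (k : ℝ) / N := by
    intro k l hkl
    rw [div_left_inj' hN0] at hkl
    exact_mod_cast mul_left_cancel₀ Real.two_pi_pos.ne' hkl
  rw [← Set.ncard_coe_finset, ← Set.ncard_image_of_injective _ hinj]
  congr 1
  ext q
  constructor
  · rintro ⟨⟨k, hk, rfl⟩, hq⟩
    exact ⟨k, by simpa [hk] using (h k).mp hq, rfl⟩
  · rintro ⟨k, hk, rfl⟩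
    rw [Finset.mem_coe, Finset.mem_filter, Finset.mem_range] at hk
    exact ⟨⟨k, hk.1, rfl⟩, (h k).mpr hk.2⟩

theorem ncard_momenta_cos_eq_one (hN : Odd N) (hnN : n + 2 < N) :
    {q | q ∈ momenta N ∧ Real.cos (((n : ℝ) + 2) * q) = 1}.ncard = Nat.gcd N (n + 2) := by
  obtain ⟨h, m, _, hM, hm, hc⟩ := exists_gcd_decomposition hN hnN
  have hg : 0 < Nat.gcd N (n + 2) := Nat.gcd_pos_of_pos_right _ (by omega)
  generalize Nat.gcd N (n + 2) = g at *
  subst hM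
  rw [ncard_momenta_filter (φ := fun q => Real.cos (((n : ℝ) + 2) * q) = 1)
    (P := fun k => m * k ≡ 0 [MOD 2 * h + 1]) fun k => ?_, count_mul_modEq g 0 (by omega) hc]
  rw [add_two_mul_div_eq hg hm, cos_two_pi_mul_div_eq_one_iff (by omega)]

theorem ncard_momenta_cos_eq_neg (hN : Odd N) (hnN : n + 2 < N) :
    {q | q ∈ momenta N ∧ Real.cos (((n : ℝ) + 2) * q) =
      -Real.cos (Real.pi * (Nat.gcd N (n + 2) : ℝ) / N)}.ncard = 2 * Nat.gcd N (n + 2) := by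
  obtain ⟨h, m, hpos, hM, hm, hc⟩ := exists_gcd_decomposition hN hnN
  have hg : 0 < Nat.gcd N (n + 2) := Nat.gcd_pos_of_pos_right _ (by omega)
  generalize Nat.gcd N (n + 2) = g at *
  subst hM
  have hg' : (g : ℝ) ≠ 0 := Nat.cast_ne_zero.mpr hg.ne'
  have e : Real.pi * (g : ℝ) / (g * (2 * h + 1) : ℕ) = Real.pi / (2 * h + 1 : ℕ) := by
    push_cast
    field_simp
  rw [e, ncard_momenta_filter
    (φ := fun q => Real.cos (((n : ℝ) + 2) * q) = -Real.cos (Real.pi / (2 * h + 1 : ℕ)))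
    (P := fun k => m * k ≡ h [MOD 2 * h + 1] ∨ m * k ≡ h + 1 [MOD 2 * h + 1]) fun k => ?_,
    Finset.filter_or, Finset.card_union_of_disjoint,
    count_mul_modEq g h (by omega) hc, count_mul_modEq g (h + 1) (by omega) hc, two_mul]
  -- The classes of `h` and `h + 1` differ modulo `2h + 1` because `h > 0`.
  · rw [Finset.disjoint_filter]
    intro k _ h1 h2
    have h3 := h1.symm.trans h2
    rw [Nat.ModEq, Nat.mod_eq_of_lt (by omega), Nat.mod_eq_of_lt (by omega)] at h3
    omega
  · rw [add_two_mul_div_eq hg hm, (neg_cos_pi_div_le h (m * k)).2]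

theorem groundMomenta_of_pos (hN : Odd N) (hnN : n + 2 < N) (hlam : lam ∈ Set.Ioo (0 : ℝ) 1) :
    groundMomenta N n lam = {q | q ∈ momenta N ∧ Real.cos (((n : ℝ) + 2) * q) =
      -Real.cos (Real.pi * (Nat.gcd N (n + 2) : ℝ) / N)} := by
  have hg : 0 < Nat.gcd N (n + 2) := Nat.gcd_pos_of_pos_right _ (by omega)
  -- That the lower bound is attained follows from the count `2g > 0`; no explicit momentum is
  -- needed.
  have hne : {q | q ∈ momenta N ∧ Real.cos (((n : ℝ) + 2) * q) =
      -Real.cos (Real.pi * (Nat.gcd N (n + 2) : ℝ) / N)}.Nonempty := by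
    apply Set.nonempty_of_ncard_ne_zero
    rw [ncard_momenta_cos_eq_neg hN hnN]
    omega
  have hle : ∀ l : Fin N, -Real.cos (Real.pi * (Nat.gcd N (n + 2) : ℝ) / N) ≤
      Real.cos (((n : ℝ) + 2) * momentum l) := by
    intro l
    obtain ⟨h, m, hpos, hM, hm, hc⟩ := exists_gcd_decomposition hN hnN
    have hg' : ((Nat.gcd N (n + 2) : ℕ) : ℝ) ≠ 0 := Nat.cast_ne_zero.mpr hg.ne'
    have e : Real.pi * (Nat.gcd N (n + 2) : ℝ) / N = Real.pi / (2 * h + 1 : ℕ) := by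
      have : (N : ℝ) = Nat.gcd N (n + 2) * (2 * h + 1 : ℕ) := by exact_mod_cast hM
      rw [this]
      field_simp
    have e2 := add_two_mul_div_eq (M := 2 * h + 1) hg hm l.val
    rw [← hM] at e2
    rw [e, momentum, e2]
    exact (neg_cos_pi_div_le h _).1
  ext q
  rw [mem_groundMomenta_iff (by linarith [hlam.1]), Set.mem_ofPred_eq]
  refine and_congr_right fun hq => ⟨fun hl => ?_, fun hq l => ?_⟩
  · obtain ⟨p, hp, hp'⟩ := hne
    obtain ⟨l, rfl⟩ := momenta_eq_range.le hp
    obtain ⟨k, rfl⟩ := momenta_eq_range.le hq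
    have := hl l
    rw [hp', mul_le_mul_iff_right₀ hlam.1] at this
    exact le_antisymm this (hle k)
  · rw [hq, mul_le_mul_iff_right₀ hlam.1]
    exact hle l

end

/-! ### The explicit momenta for `n = 4`. -/

section

variable {N : ℕ} [NeZero N] {lam : ℝ}

/-- The hypothesis says that `6q = (2d+1)π ± πg/N`. -/
theorem cos_six_mul_momentum {g k d : ℕ}
    (h : 12 * k = N * (2 * d + 1) + g ∨ 12 * k + g = N * (2 * d + 1)) :
    Real.cos (6 * (2 * Real.pi * k / N)) = -Real.cos (Real.pi * g / N) := by
  have hN0 : (N : ℝ) ≠ 0 := Nat.cast_ne_zero.mpr (NeZero.ne N)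
  rcases h with h | h
  · have h' : 12 * (k : ℝ) = N * (2 * d + 1) + g := by exact_mod_cast h
    have e : 6 * (2 * Real.pi * k / N) = Real.pi * g / N + Real.pi + d * (2 * Real.pi) := by
      field_simp
      linear_combination h'
    rw [e, Real.cos_add_nat_mul_two_pi, Real.cos_add_pi]
  · have h' : 12 * (k : ℝ) + g = N * (2 * d + 1) := by exact_mod_cast h
    have e : 6 * (2 * Real.pi * k / N) = Real.pi - Real.pi * g / N + d * (2 * Real.pi) := by
      field_simp
      linear_combination h'
    rw [e, Real.cos_add_nat_mul_two_pi, Real.cos_pi_sub]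

/-- Since `Q` is already known to have `2g` elements, it suffices to exhibit `2g` indices whose
momenta lie in it. -/
theorem groundMomenta_four_eq_image (hN : Odd N) (hnN : 4 + 2 < N)
    (hlam : lam ∈ Set.Ioo (0 : ℝ) 1) {g : ℕ} (hg : Nat.gcd N 6 = g) {K : Finset ℕ}
    (hcard : K.card = 2 * g)
    (hK : ∀ k ∈ K, k < N ∧ ∃ d, 12 * k = N * (2 * d + 1) + g ∨ 12 * k + g = N * (2 * d + 1)) :
    groundMomenta N 4 lam = (fun k : ℕ => 2 * Real.pi / N * (k : ℝ)) '' K := by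
  have hN0 : (N : ℝ) ≠ 0 := Nat.cast_ne_zero.mpr (NeZero.ne N)
  have hinj : Function.Injective fun k : ℕ => 2 * Real.pi / N * (k : ℝ) := by
    intro k l hkl
    have h2 : 2 * Real.pi / N ≠ 0 := div_ne_zero Real.two_pi_pos.ne' hN0
    exact_mod_cast mul_left_cancel₀ h2 hkl
  symm
  refine Set.eq_of_subset_of_ncard_le ?_ ?_ finite_groundMomenta
  · rw [groundMomenta_of_pos hN hnN hlam]
    rintro _ ⟨k, hk, rfl⟩
    obtain ⟨hkN, d, hd⟩ := hK k hk
    have e : 2 * Real.pi / N * (k : ℝ) = 2 * Real.pi * k / N := by ring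
    refine ⟨⟨k, hkN, e⟩, ?_⟩
    have h6 : ((4 : ℕ) : ℝ) + 2 = 6 := by norm_num
    beta_reduce
    rw [e, h6, cos_six_mul_momentum hd, hg]
  · rw [groundMomenta_of_pos hN hnN hlam, ncard_momenta_cos_eq_neg hN hnN,
      Set.ncard_image_of_injective _ hinj, Set.ncard_coe_finset, hcard, hg]

theorem groundMomenta_four_of_mod_one (hN : Odd N) (hnN : 4 + 2 < N)
    (hlam : lam ∈ Set.Ioo (0 : ℝ) 1) (h : N % 12 = 1) : Nat.gcd N 6 = 1 ∧
    groundMomenta N 4 lam = {2 * Real.pi / N * (((N : ℝ) - 1) / 12),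
      2 * Real.pi / N * ((11 * (N : ℝ) + 1) / 12)} := by
  obtain ⟨t, ht⟩ : ∃ t, N = 12 * t + 1 := ⟨N / 12, by omega⟩
  have hg : Nat.gcd N 6 = 1 := by
    rw [Nat.gcd_comm, Nat.gcd_rec, show N % 6 = 1 by omega]
    rfl
  refine ⟨hg, ?_⟩
  rw [groundMomenta_four_eq_image hN hnN hlam hg (K := {t, 11 * t + 1})
    (Finset.card_pair (by omega)) ?_]
  · rw [Finset.coe_pair, Set.image_pair, ht]
    push_cast
    congr 3 <;> ring
  · intro k hk
    rw [Finset.mem_insert, Finset.mem_singleton] at hk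
    rcases hk with rfl | rfl
    -- The witness `d` is read off from the coefficient `2d + 1` of `N` in the numerator of the
    -- momentum, here `1` and then `11`.
    · exact ⟨by omega, 0, by omega⟩
    · exact ⟨by omega, 5, by omega⟩

theorem groundMomenta_four_of_mod_three (hN : Odd N) (hnN : 4 + 2 < N)
    (hlam : lam ∈ Set.Ioo (0 : ℝ) 1) (h : N % 12 = 3) : Nat.gcd N 6 = 3 ∧
    groundMomenta N 4 lam = {2 * Real.pi / N * (((N : ℝ) - 3) / 12),
      2 * Real.pi / N * ((3 * (N : ℝ) + 3) / 12), 2 * Real.pi / N * ((5 * (N : ℝ) - 3) / 12),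
      2 * Real.pi / N * ((7 * (N : ℝ) + 3) / 12), 2 * Real.pi / N * ((9 * (N : ℝ) - 3) / 12),
      2 * Real.pi / N * ((11 * (N : ℝ) + 3) / 12)} := by
  obtain ⟨t, ht⟩ : ∃ t, N = 12 * t + 3 := ⟨N / 12, by omega⟩
  have hg : Nat.gcd N 6 = 3 := by
    rw [Nat.gcd_comm, Nat.gcd_rec, show N % 6 = 3 by omega]
    rfl
  refine ⟨hg, ?_⟩
  rw [groundMomenta_four_eq_image hN hnN hlam hg
    (K := {t, 3 * t + 1, 5 * t + 1, 7 * t + 2, 9 * t + 2, 11 * t + 3}) ?_ ?_]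
  · simp only [Finset.coe_insert, Finset.coe_singleton, Set.image_insert_eq, Set.image_singleton,
      ht]
    have e1 : (((12 * t + 3 : ℕ) : ℝ) - 3) / 12 = t := by push_cast; ring
    have e2 : (3 * ((12 * t + 3 : ℕ) : ℝ) + 3) / 12 = (3 * t + 1 : ℕ) := by push_cast; ring
    have e3 : (5 * ((12 * t + 3 : ℕ) : ℝ) - 3) / 12 = (5 * t + 1 : ℕ) := by push_cast; ring
    have e4 : (7 * ((12 * t + 3 : ℕ) : ℝ) + 3) / 12 = (7 * t + 2 : ℕ) := by push_cast; ring
    have e5 : (9 * ((12 * t + 3 : ℕ) : ℝ) - 3) / 12 = (9 * t + 2 : ℕ) := by push_cast; ring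
    have e6 : (11 * ((12 * t + 3 : ℕ) : ℝ) + 3) / 12 = (11 * t + 3 : ℕ) := by push_cast; ring
    rw [e1, e2, e3, e4, e5, e6]
  · repeat rw [Finset.card_insert_of_notMem
      (by simp only [Finset.mem_insert, Finset.mem_singleton]; omega)]
    rfl
  · intro k hk
    simp only [Finset.mem_insert, Finset.mem_singleton] at hk
    rcases hk with rfl | rfl | rfl | rfl | rfl | rfl
    -- The coefficients `2d + 1` of `N` run through `1, 3, 5, 7, 9, 11`, with the sign in front of
    -- `3` alternating.
    · exact ⟨by omega, 0, by omega⟩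
    · exact ⟨by omega, 1, by omega⟩
    · exact ⟨by omega, 2, by omega⟩
    · exact ⟨by omega, 3, by omega⟩
    · exact ⟨by omega, 4, by omega⟩
    · exact ⟨by omega, 5, by omega⟩

end

end ClusterIsing

end

theorem mainTheorem3 (N n : ℕ) [NeZero N] (hN : Odd N) (hn : Even n) (hnN : n + 2 < N)
    (lam : ℝ) :
    -- the ground states, for all couplings of modulus less than one
    (lam ∈ Set.Ioo (-1 : ℝ) 1 →
      IsLeast (ClusterIsing.energyLevels (ClusterIsing.hamiltonian N n lam))
        (ClusterIsing.groundEnergy (ClusterIsing.hamiltonian N n lam)) ∧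
      LinearIndependent ℂ (ClusterIsing.groundFamily N n lam) ∧
      Submodule.span ℂ (Set.range (ClusterIsing.groundFamily N n lam)) =
        ClusterIsing.groundSpace (ClusterIsing.hamiltonian N n lam) ∧
      ∀ q ∈ ClusterIsing.groundMomenta N n lam,
        Matrix.mulVec (ClusterIsing.translation N) (ClusterIsing.singleMode N n lam q) =
          Complex.exp (Complex.I * q) • ClusterIsing.singleMode N n lam q ∧
        Matrix.mulVec (ClusterIsing.translation N)
            (Matrix.mulVec (ClusterIsing.parityX N) (ClusterIsing.singleMode N n lam q)) =
          Complex.exp (Complex.I * q) •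
            Matrix.mulVec (ClusterIsing.parityX N) (ClusterIsing.singleMode N n lam q)) ∧
    -- degeneracy and momenta for positive coupling
    (lam ∈ Set.Ioo (0 : ℝ) 1 →
      Module.finrank ℂ (ClusterIsing.groundSpace (ClusterIsing.hamiltonian N n lam)) =
        4 * Nat.gcd N (n + 2) ∧
      (ClusterIsing.groundMomenta N n lam).ncard = 2 * Nat.gcd N (n + 2) ∧
      ClusterIsing.groundMomenta N n lam =
        {q | q ∈ ClusterIsing.momenta N ∧
          Real.cos (((n : ℝ) + 2) * q) = -Real.cos (Real.pi * (Nat.gcd N (n + 2) : ℝ) / N)}) ∧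
    -- degeneracy and momenta for negative coupling
    (lam ∈ Set.Ioo (-1 : ℝ) 0 →
      Module.finrank ℂ (ClusterIsing.groundSpace (ClusterIsing.hamiltonian N n lam)) =
        2 * Nat.gcd N (n + 2) ∧
      (ClusterIsing.groundMomenta N n lam).ncard = Nat.gcd N (n + 2) ∧
      ClusterIsing.groundMomenta N n lam =
        {q | q ∈ ClusterIsing.momenta N ∧ Real.cos (((n : ℝ) + 2) * q) = 1}) ∧
    -- the examples with n = 4 and positive coupling
    (lam ∈ Set.Ioo (0 : ℝ) 1 → n = 4 → N % 12 = 1 →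
      Module.finrank ℂ (ClusterIsing.groundSpace (ClusterIsing.hamiltonian N n lam)) = 4 ∧
      ClusterIsing.groundMomenta N n lam =
        {2 * Real.pi / N * (((N : ℝ) - 1) / 12), 2 * Real.pi / N * ((11 * (N : ℝ) + 1) / 12)}) ∧
    (lam ∈ Set.Ioo (0 : ℝ) 1 → n = 4 → N % 12 = 3 →
      Module.finrank ℂ (ClusterIsing.groundSpace (ClusterIsing.hamiltonian N n lam)) = 12 ∧
      ClusterIsing.groundMomenta N n lam =
        {2 * Real.pi / N * (((N : ℝ) - 3) / 12), 2 * Real.pi / N * ((3 * (N : ℝ) + 3) / 12),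
          2 * Real.pi / N * ((5 * (N : ℝ) - 3) / 12), 2 * Real.pi / N * ((7 * (N : ℝ) + 3) / 12),
          2 * Real.pi / N * ((9 * (N : ℝ) - 3) / 12),
          2 * Real.pi / N * ((11 * (N : ℝ) + 3) / 12)}) := by
  have hpos : lam ∈ Set.Ioo (0 : ℝ) 1 → lam ∈ Set.Ioo (-1 : ℝ) 1 :=
    fun h => ⟨by linarith [h.1], h.2⟩
  have hneg : lam ∈ Set.Ioo (-1 : ℝ) 0 → lam ∈ Set.Ioo (-1 : ℝ) 1 :=
    fun h => ⟨h.1, by linarith [h.2]⟩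
  refine ⟨fun h => ?_, fun h => ?_, fun h => ?_, ?_, ?_⟩
  · obtain ⟨h1, h2⟩ := ClusterIsing.isLeast_groundEnergy_and_span hN hn hnN h
    exact ⟨h1, ClusterIsing.linearIndependent_groundFamily hN h.1, h2,
      fun q hq => ClusterIsing.translation_mulVec_of_mem_groundMomenta hN h.1 hq⟩
  · have hQ := ClusterIsing.groundMomenta_of_pos hN hnN h
    have hcard : (ClusterIsing.groundMomenta N n lam).ncard = 2 * Nat.gcd N (n + 2) := by
      rw [hQ, ClusterIsing.ncard_momenta_cos_eq_neg hN hnN]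
    refine ⟨?_, hcard, hQ⟩
    rw [ClusterIsing.finrank_groundSpace hN hn hnN (hpos h), hcard]
    ring
  · have hQ := ClusterIsing.groundMomenta_of_neg (N := N) (n := n) h
    have hcard : (ClusterIsing.groundMomenta N n lam).ncard = Nat.gcd N (n + 2) := by
      rw [hQ, ClusterIsing.ncard_momenta_cos_eq_one hN hnN]
    exact ⟨by rw [ClusterIsing.finrank_groundSpace hN hn hnN (hneg h), hcard], hcard, hQ⟩
  · rintro h rfl hmod
    obtain ⟨hg, hQ⟩ := ClusterIsing.groundMomenta_four_of_mod_one hN hnN h hmod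
    refine ⟨?_, hQ⟩
    rw [ClusterIsing.finrank_groundSpace hN hn hnN (hpos h),
      ClusterIsing.groundMomenta_of_pos hN hnN h, ClusterIsing.ncard_momenta_cos_eq_neg hN hnN, hg]
  · rintro h rfl hmod
    obtain ⟨hg, hQ⟩ := ClusterIsing.groundMomenta_four_of_mod_three hN hnN h hmod
    refine ⟨?_, hQ⟩
    rw [ClusterIsing.finrank_groundSpace hN hn hnN (hpos h),
      ClusterIsing.groundMomenta_of_pos hN hnN h, ClusterIsing.ncard_momenta_cos_eq_neg hN hnN, hg]
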